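/- Consider a transmitter and two receivers that communicate over a broadcast erasure channel with independent erasures. Let $\delta_1,\delta_2\in[0,1)$ and $\epsilon_1,\epsilon_2\in[0,1]$, and write $\bar i=3-i$. For block length $n$ and rates $R_1,R_2\ge 0$, the messages $W_1,W_2$ are independent and uniformly distributed binary strings of lengths $m_i=\lceil nR_i\rceil$. Receiver $i$ has cached the string $W_{\bar i|i}=(E_i[\ell]\,W_{\bar i}[\ell])_{\ell\le m_{\bar i}}$, where the cache index $E_i$ is i.i.d. Bernoulli$(1-\epsilon_i)$. At time $t\le n$ the transmitter sends $X[t]\in\mathbb F_2$ and receiver $i$ observes $Y_i[t]=S_i[t]X[t]$, where the channel state $S_i$ is i.i.d. Bernoulli$(1-\delta_i)$. The strings $W_1,W_2,E_1,E_2,S_1,S_2$ are mutually independent. The transmitter is non-blind and has no channel state information: $X^n$ is a function of $(W_1,W_2,E_1,E_2)$. Receiver $i$ forms an estimate $\widehat W_i$ of $W_i$ as a function of $(Y_i^n,S_i^n,W_{\bar i|i},E_1,E_2)$; in particular both receivers know the cache indices. The pair $(R_1,R_2)$ is achievable if there are encoders and decoders for all $n$ with $\Pr(\widehat W_i\ne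 W_i)\to 0$ as $n\to\infty$ for $i=1,2$, and the capacity region is the closure of the set of achievable pairs. Then the capacity region is exactly $$\left\{(R_1,R_2):\ R_1\ge 0,\ R_2\ge 0,\ \beta_1R_1+R_2\le 1-\delta_2,\ R_1+\beta_2R_2\le 1-\delta_1\right\},\qquad \beta_i=\epsilon_{\bar i}\min\left\{\frac{1-\delta_{\bar i}}{1-\delta_i},\,1\right\}.$$ -/

import Mathlib

open Filter Topology

namespace CachedBEC

/-- Binary strings of length `k`; all symbols are elements of the field with two elements. -/
abbrev Bits (k : ℕ) : Type := Fin k → ZMod 2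

/-- Probability that an i.i.d. Bernoulli(`p`) string of length `k` (each entry is `1` with
probability `p` and `0` with probability `1 - p`) equals `s`. -/
noncomputable def bernoulliWeight (p : ℝ) {k : ℕ} (s : Bits k) : ℝ :=
  ∏ t, if s t = 1 then p else 1 - p

/-- The parameters of the problem: `δᵢ` is the erasure probability of the channel to receiver `i`;
a bit intended for the other receiver is missing from the cache of receiver `i` with
probability `εᵢ`. -/
structure Params where
  δ₁ : ℝ
  δ₂ : ℝ
  ε₁ : ℝ
  ε₂ : ℝ

/-- Joint probability of one realization of all the random objects:
* the messages `w₁`, `w₂` are uniformly distributed;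
* the cache index `e₁` of receiver 1 (over the bits of `w₂`) is i.i.d. Bernoulli(`1 - ε₁`), and the
  cache index `e₂` of receiver 2 (over the bits of `w₁`) is i.i.d. Bernoulli(`1 - ε₂`);
* the channel state `sᵢ` of receiver `i` is i.i.d. Bernoulli(`1 - δᵢ`);
* all six are mutually independent. -/
noncomputable def jointWeight (P : Params) {n m₁ m₂ : ℕ} (_w₁ : Bits m₁) (_w₂ : Bits m₂)
    (e₁ : Bits m₂) (e₂ : Bits m₁) (s₁ s₂ : Bits n) : ℝ :=
  (1 / 2) ^ m₁ * (1 / 2) ^ m₂ * bernoulliWeight (1 - P.ε₁) e₁ * bernoulliWeight (1 - P.ε₂) e₂ *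
    bernoulliWeight (1 - P.δ₁) s₁ * bernoulliWeight (1 - P.δ₂) s₂

open Classical in
/-- Probability of an event `A` in `(w₁, w₂, e₁, e₂, s₁, s₂)`. -/
noncomputable def prob (P : Params) {n m₁ m₂ : ℕ}
    (A : Bits m₁ → Bits m₂ → Bits m₂ → Bits m₁ → Bits n → Bits n → Prop) : ℝ :=
  ∑ w₁ : Bits m₁, ∑ w₂ : Bits m₂, ∑ e₁ : Bits m₂, ∑ e₂ : Bits m₁, ∑ s₁ : Bits n, ∑ s₂ : Bits n,
    if A w₁ w₂ e₁ e₂ s₁ s₂ then jointWeight P w₁ w₂ e₁ e₂ s₁ s₂ else 0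

/-- A block code of length `n` with `m₁` and `m₂` message bits, for a non-blind transmitter without
channel state information. Products of strings are taken entry by entry, so that `eᵢ * w` is the
cached side information and `sᵢ * x` the channel output.

The channel input depends on both messages and both cache indices, that is, on the cached and the
non-cached part of each message, but on no channel state. Receiver `i` decodes its message from its
channel output, its own channel state, the cache indices, and the cached bits of the other
message. -/
structure Code (n m₁ m₂ : ℕ) where
  /-- `encode w₁ w₂ e₁ e₂` is the channel input. -/
  encode : Bits m₁ → Bits m₂ → Bits m₂ → Bits m₁ → Bits n
  /-- `decode₁ y₁ s₁ e₁ e₂ (e₁ * w₂)` is the estimate of `w₁` at receiver 1. -/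
  decode₁ : Bits n → Bits n → Bits m₂ → Bits m₁ → Bits m₂ → Bits m₁
  /-- `decode₂ y₂ s₂ e₁ e₂ (e₂ * w₁)` is the estimate of `w₂` at receiver 2. -/
  decode₂ : Bits n → Bits n → Bits m₂ → Bits m₁ → Bits m₁ → Bits m₂

/-- Average probability of error at receiver 1. -/
noncomputable def Code.error₁ {n m₁ m₂ : ℕ} (c : Code n m₁ m₂) (P : Params) : ℝ :=
  prob P fun w₁ w₂ e₁ e₂ (s₁ _s₂ : Bits n) =>
    c.decode₁ (s₁ * c.encode w₁ w₂ e₁ e₂) s₁ e₁ e₂ (e₁ * w₂) ≠ w₁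

/-- Average probability of error at receiver 2. -/
noncomputable def Code.error₂ {n m₁ m₂ : ℕ} (c : Code n m₁ m₂) (P : Params) : ℝ :=
  prob P fun w₁ w₂ e₁ e₂ (_s₁ s₂ : Bits n) =>
    c.decode₂ (s₂ * c.encode w₁ w₂ e₁ e₂) s₂ e₁ e₂ (e₂ * w₁) ≠ w₂

/-- The rate pair `R` is achievable: for every block length `n` there is a code that carries
`⌈n Rᵢ⌉` bits for receiver `i`, such that both error probabilities tend to zero. -/
def Achievable (P : Params) (R : ℝ × ℝ) : Prop :=
  0 ≤ R.1 ∧ 0 ≤ R.2 ∧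
    ∃ c : ∀ n : ℕ, Code n ⌈(n : ℝ) * R.1⌉₊ ⌈(n : ℝ) * R.2⌉₊,
      Tendsto (fun n => (c n).error₁ P) atTop (𝓝 0) ∧
      Tendsto (fun n => (c n).error₂ P) atTop (𝓝 0)

/-- The capacity region: the closure of the set of achievable rate pairs. -/
def capacityRegion (P : Params) : Set (ℝ × ℝ) :=
  closure {R | Achievable P R}

/-- The coefficient `β₁`. -/
noncomputable def Params.β₁ (P : Params) : ℝ :=
  P.ε₂ * min ((1 - P.δ₂) / (1 - P.δ₁)) 1

/-- The coefficient `β₂`. -/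
noncomputable def Params.β₂ (P : Params) : ℝ :=
  P.ε₁ * min ((1 - P.δ₁) / (1 - P.δ₂)) 1

end CachedBEC

/-! Converse. Fix the cache indices and let `G S` be the entropy of the inputs at the positions in
`S` given W₂ and the part of W₁ cached at receiver 2. Receiver 2 gets at most one bit per unerased
position and must spend about m₂ of them on W₂, so m₂ + E `G` over its channel is at most about n(1
- δ₂). Receiver 1, told also all of W₂, still has to recover the uncached bits of W₁, so E `G` over
its channel is at least about ε₂m₁. As `G` is monotone and submodular, the two expectations compare
with the factor min((1 - δ₂)/(1 - δ₁), 1) (`min_mul_bernoulliMean_le`). This gives `Code.converse`;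
the other bound follows by exchanging the receivers.

Achievability. Let δ₁ ≤ δ₂. A fraction a of the time carries random linear combinations of the bits
of W₁ that receiver 2 lacks; the rest carries combinations of its cached bits of W₁ and all of W₂.
Receiver 2 uses only the second phase and cancels W₁ there. Receiver 1 uses both phases and resolves
the uncached bits of W₂ as well. Eliminating a from the three resulting inequalities leaves exactly
the two rate constraints.

Entropies are computed from fibre sizes: H(f | g) is `equivocation g` minus the equivocation of the
pair (f, g). -/

namespace CachedBEC

/-! ### Expectations over Bernoulli strings -/

theorem zmod_two_eq_zero_or_one (x : ZMod 2) : x = 0 ∨ x = 1 := by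
  revert x; decide

/-- Expectation of `f` under an i.i.d. Bernoulli(`p`) string. -/
noncomputable def bernoulliMean (p : ℝ) {k : ℕ} (f : Bits k → ℝ) : ℝ :=
  ∑ s, bernoulliWeight p s * f s

/-- Independence of the positions. The moments and generating functions below arise from it by a
choice of `φ`. -/
theorem bernoulliMean_prod (p : ℝ) {k : ℕ} (φ : Fin k → ZMod 2 → ℝ) :
    bernoulliMean p (fun s => ∏ t, φ t (s t)) = ∏ t, (p * φ t 1 + (1 - p) * φ t 0) := by
  have h (t : Fin k) : p * φ t 1 + (1 - p) * φ t 0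
      = ∑ x : ZMod 2, (if x = 1 then p else 1 - p) * φ t x := by
    have : (Finset.univ : Finset (ZMod 2)) = {0, 1} := by decide
    rw [this, Finset.sum_pair (by decide)]
    simp [add_comm]
  simp only [bernoulliMean, bernoulliWeight, ← Finset.prod_mul_distrib, h]
  rw [Finset.prod_univ_sum, Fintype.piFinset_univ]

theorem bernoulliMean_const (p : ℝ) {k : ℕ} (a : ℝ) :
    bernoulliMean p (fun _ : Bits k => a) = a := by
  have := bernoulliMean_prod p (k := k) (fun _ _ => 1)
  simp only [bernoulliMean, Finset.prod_const_one, mul_one, add_sub_cancel] at this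
  rw [bernoulliMean, ← Finset.sum_mul, this, one_mul]

theorem bernoulliMean_add (p : ℝ) {k : ℕ} (f g : Bits k → ℝ) :
    bernoulliMean p (fun s => f s + g s) = bernoulliMean p f + bernoulliMean p g := by
  simp [bernoulliMean, mul_add, Finset.sum_add_distrib]

theorem bernoulliMean_sub (p : ℝ) {k : ℕ} (f g : Bits k → ℝ) :
    bernoulliMean p (fun s => f s - g s) = bernoulliMean p f - bernoulliMean p g := by
  simp [bernoulliMean, mul_sub, Finset.sum_sub_distrib]

theorem bernoulliMean_const_mul (p : ℝ) {k : ℕ} (a : ℝ) (f : Bits k → ℝ) :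
    bernoulliMean p (fun s => a * f s) = a * bernoulliMean p f := by
  simp [bernoulliMean, Finset.mul_sum, mul_left_comm]

theorem bernoulliMean_mul_const (p : ℝ) {k : ℕ} (a : ℝ) (f : Bits k → ℝ) :
    bernoulliMean p (fun s => f s * a) = bernoulliMean p f * a := by
  simp [bernoulliMean, Finset.sum_mul, mul_assoc]

theorem bernoulliMean_sum (p : ℝ) {k : ℕ} {ι : Type*} (S : Finset ι) (f : ι → Bits k → ℝ) :
    bernoulliMean p (fun s => ∑ i ∈ S, f i s) = ∑ i ∈ S, bernoulliMean p (f i) := by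
  simp only [bernoulliMean, Finset.mul_sum]
  exact Finset.sum_comm

theorem bernoulliWeight_nonneg {p : ℝ} (h₀ : 0 ≤ p) (h₁ : p ≤ 1) {k : ℕ} (s : Bits k) :
    0 ≤ bernoulliWeight p s := by
  refine Finset.prod_nonneg fun t _ => ?_
  split_ifs <;> linarith

theorem bernoulliMean_mono {p : ℝ} (h₀ : 0 ≤ p) (h₁ : p ≤ 1) {k : ℕ} {f g : Bits k → ℝ}
    (h : ∀ s, f s ≤ g s) : bernoulliMean p f ≤ bernoulliMean p g :=
  Finset.sum_le_sum fun s _ => mul_le_mul_of_nonneg_left (h s) (bernoulliWeight_nonneg h₀ h₁ s)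

theorem bernoulliMean_coord (p : ℝ) {k : ℕ} (t : Fin k) (φ : ZMod 2 → ℝ) :
    bernoulliMean p (fun s => φ (s t)) = p * φ 1 + (1 - p) * φ 0 := by
  have := bernoulliMean_prod p (fun i x => if i = t then φ x else 1)
  simp only [Finset.prod_ite_eq', Finset.mem_univ, if_true] at this
  rw [this, Finset.prod_eq_single t]
  · simp
  · intro b _ hb; simp [hb]
  · simp

theorem bernoulliMean_sum_coord (p : ℝ) {k : ℕ} (φ : ZMod 2 → ℝ) :
    bernoulliMean p (fun s : Bits k => ∑ t, φ (s t)) = k * (p * φ 1 + (1 - p) * φ 0) := by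
  rw [bernoulliMean_sum]
  simp only [bernoulliMean_coord, Finset.sum_const, Finset.card_univ, Fintype.card_fin,
    nsmul_eq_mul]

/-- Thinning: the product of independent Bernoulli(`p`) and Bernoulli(`q`) strings is a
Bernoulli(`p * q`) string. -/
theorem bernoulliMean_thinning (p q : ℝ) {k : ℕ} (g : Bits k → ℝ) :
    bernoulliMean p (fun s => bernoulliMean q (fun t => g (s * t))) = bernoulliMean (p * q) g := by
  -- Indicators of single strings are products over positions, so independence reduces the claim to
  -- one position.
  have hg (s t : Bits k) : g (s * t) = ∑ r, g r * ∏ i, if s i * t i = r i then (1 : ℝ) else 0 := by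
    have h (r : Bits k) : (∏ i, if s i * t i = r i then (1 : ℝ) else 0)
        = if s * t = r then 1 else 0 := by
      rw [Finset.prod_ite_zero]
      simp [funext_iff]
    simp [h]
  simp only [hg, bernoulliMean_sum, bernoulliMean_const_mul]
  rw [bernoulliMean]
  refine Finset.sum_congr rfl fun r _ => ?_
  rw [mul_comm (bernoulliWeight _ _)]
  congr 1
  have h1 (s : Bits k) := bernoulliMean_prod q (fun i x => if s i * x = r i then (1 : ℝ) else 0)
  simp only [h1]
  rw [bernoulliMean_prod p (fun i x => q * (if x * 1 = r i then (1 : ℝ) else 0)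
    + (1 - q) * (if x * 0 = r i then (1 : ℝ) else 0))]
  refine Finset.prod_congr rfl fun i _ => ?_
  rcases zmod_two_eq_zero_or_one (r i) with h | h <;> simp [h]
  ring

open Classical in
/-- Fraction of the message pairs with property `A`. -/
noncomputable def messageFraction {m₁ m₂ : ℕ} (A : Bits m₁ → Bits m₂ → Prop) : ℝ :=
  (1 / 2) ^ m₁ * (1 / 2) ^ m₂ * ∑ w₁, ∑ w₂, if A w₁ w₂ then 1 else 0

/-- With the messages innermost, both directions can work at fixed cache indices and channel states
and average afterwards. -/
theorem prob_eq (P : Params) {n m₁ m₂ : ℕ}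
    (A : Bits m₁ → Bits m₂ → Bits m₂ → Bits m₁ → Bits n → Bits n → Prop) :
    prob P A = bernoulliMean (1 - P.ε₁) fun e₁ => bernoulliMean (1 - P.ε₂) fun e₂ =>
      bernoulliMean (1 - P.δ₁) fun s₁ => bernoulliMean (1 - P.δ₂) fun s₂ =>
        messageFraction fun w₁ w₂ => A w₁ w₂ e₁ e₂ s₁ s₂ := by
  classical
  simp only [messageFraction, bernoulliMean_const_mul, bernoulliMean_sum]
  simp only [prob, Finset.mul_sum, bernoulliMean, jointWeight]
  refine Finset.sum_congr rfl fun w₁ _ => Finset.sum_congr rfl fun w₂ _ =>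
    Finset.sum_congr rfl fun e₁ _ => Finset.sum_congr rfl fun e₂ _ =>
    Finset.sum_congr rfl fun s₁ _ => Finset.sum_congr rfl fun s₂ _ => ?_
  split_ifs <;> ring

theorem Code.error₁_eq {n m₁ m₂ : ℕ} (c : Code n m₁ m₂) (P : Params) :
    c.error₁ P = bernoulliMean (1 - P.ε₁) fun e₁ => bernoulliMean (1 - P.ε₂) fun e₂ =>
      bernoulliMean (1 - P.δ₁) fun s => messageFraction fun w₁ w₂ =>
        c.decode₁ (s * c.encode w₁ w₂ e₁ e₂) s e₁ e₂ (e₁ * w₂) ≠ w₁ := by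
  simp only [Code.error₁, prob_eq, bernoulliMean_const]

theorem Code.error₂_eq {n m₁ m₂ : ℕ} (c : Code n m₁ m₂) (P : Params) :
    c.error₂ P = bernoulliMean (1 - P.ε₁) fun e₁ => bernoulliMean (1 - P.ε₂) fun e₂ =>
      bernoulliMean (1 - P.δ₂) fun s => messageFraction fun w₁ w₂ =>
        c.decode₂ (s * c.encode w₁ w₂ e₁ e₂) s e₁ e₂ (e₂ * w₁) ≠ w₂ := by
  simp only [Code.error₂, prob_eq, bernoulliMean_const]

/-- The parameters with the two receivers exchanged. -/
def Params.swap (P : Params) : Params := ⟨P.δ₂, P.δ₁, P.ε₂, P.ε₁⟩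

/-- The code with the two receivers exchanged. -/
def Code.swap {n m₁ m₂ : ℕ} (c : Code n m₁ m₂) : Code n m₂ m₁ where
  encode w₁ w₂ e₁ e₂ := c.encode w₂ w₁ e₂ e₁
  decode₁ y s e₁ e₂ u := c.decode₂ y s e₂ e₁ u
  decode₂ y s e₁ e₂ u := c.decode₁ y s e₂ e₁ u

theorem prob_swap (P : Params) {n m₁ m₂ : ℕ}
    (A : Bits m₁ → Bits m₂ → Bits m₂ → Bits m₁ → Bits n → Bits n → Prop) :
    prob P.swap (fun w₂ w₁ e₂ e₁ s₂ s₁ => A w₁ w₂ e₁ e₂ s₁ s₂) = prob P A := by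
  classical
  simp only [prob]
  rw [Finset.sum_comm]
  refine Finset.sum_congr rfl fun w₁ _ => Finset.sum_congr rfl fun w₂ _ => ?_
  rw [Finset.sum_comm]
  refine Finset.sum_congr rfl fun e₁ _ => Finset.sum_congr rfl fun e₂ _ => ?_
  rw [Finset.sum_comm]
  refine Finset.sum_congr rfl fun s₁ _ => Finset.sum_congr rfl fun s₂ _ => ?_
  congr 1
  simp only [jointWeight, Params.swap]
  ring

theorem Code.error₁_swap {n m₁ m₂ : ℕ} (c : Code n m₁ m₂) (P : Params) :
    c.swap.error₁ P.swap = c.error₂ P :=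
  prob_swap P _

theorem Code.error₂_swap {n m₁ m₂ : ℕ} (c : Code n m₁ m₂) (P : Params) :
    c.swap.error₂ P.swap = c.error₁ P :=
  prob_swap P _

/-- By this symmetry one converse bound and the case δ₁ ≤ δ₂ suffice. -/
theorem Achievable.swap {P : Params} {R : ℝ × ℝ} (h : Achievable P R) :
    Achievable P.swap R.swap := by
  obtain ⟨h₁, h₂, c, hc₁, hc₂⟩ := h
  refine ⟨h₂, h₁, fun n => (c n).swap, ?_, ?_⟩
  · simpa only [Code.error₁_swap] using hc₂
  · simpa only [Code.error₂_swap] using hc₁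

/-! ### Entropy of functions of a uniform point -/

section Entropy

variable {Ω α γ η : Type*} [Fintype Ω]

open Classical in
/-- Number of points that `f` does not distinguish from `ω`. -/
noncomputable def fiberCard (f : Ω → α) (ω : Ω) : ℕ :=
  (Finset.univ.filter fun ω' => f ω' = f ω).card

theorem fiberCard_pos (f : Ω → α) (ω : Ω) : 0 < fiberCard f ω :=
  Finset.card_pos.2 ⟨ω, by simp⟩

/-- Conditional entropy, in bits, of a uniformly distributed point of `Ω` given its image under `f`. -/
noncomputable def equivocation (f : Ω → α) : ℝ :=
  (∑ ω, Real.logb 2 (fiberCard f ω)) / Fintype.card Ω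

theorem equivocation_le_of_refines {f : Ω → α} {g : Ω → γ}
    (h : ∀ ω ω', f ω = f ω' → g ω = g ω') : equivocation f ≤ equivocation g := by
  refine div_le_div_of_nonneg_right (Finset.sum_le_sum fun ω _ => ?_) (Nat.cast_nonneg _)
  refine Real.logb_le_logb_of_le (by norm_num) (by exact_mod_cast fiberCard_pos f ω) ?_
  refine Nat.cast_le.2 (Finset.card_le_card fun ω' hω' => ?_)
  simp only [Finset.mem_filter, Finset.mem_univ, true_and] at hω' ⊢
  exact h _ _ hω'

theorem equivocation_congr {f : Ω → α} {g : Ω → γ}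
    (h : ∀ ω ω', f ω = f ω' ↔ g ω = g ω') : equivocation f = equivocation g :=
  le_antisymm (equivocation_le_of_refines fun ω ω' => (h ω ω').1)
    (equivocation_le_of_refines fun ω ω' => (h ω ω').2)

theorem equivocation_of_injective {f : Ω → α} (h : Function.Injective f) : equivocation f = 0 := by
  have (ω : Ω) : fiberCard f ω = 1 :=
    Finset.card_eq_one.2 ⟨ω, by ext; simp [h.eq_iff]⟩
  simp [equivocation, this]

theorem equivocation_of_card [Nonempty Ω] {f : Ω → α} {k : ℕ} (h : ∀ ω, fiberCard f ω = 2 ^ k) :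
    equivocation f = k := by
  have : (Fintype.card Ω : ℝ) ≠ 0 := by exact_mod_cast Fintype.card_ne_zero
  simp [equivocation, h, Real.logb_pow]

/-- The points of the fibre with `f ω = a` are as many as the denominator says, so together they
contribute `q a`, or nothing if there are none. -/
theorem sum_fiber_div_le_one [Fintype α] (f : Ω → α) (g : Ω → γ) (q : α → ℝ) (h₀ : ∀ a, 0 ≤ q a)
    (h₁ : ∑ a, q a ≤ 1) (z : γ) [DecidablePred fun ω => g ω = z] :
    ∑ ω with g ω = z, q (f ω) / fiberCard (fun ω => (f ω, g ω)) ω ≤ 1 := by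
  classical
  refine le_trans ?_ h₁
  rw [← Finset.sum_fiberwise _ f]
  refine Finset.sum_le_sum fun a _ => ?_
  rw [Finset.filter_filter]
  set S := Finset.univ.filter fun ω => g ω = z ∧ f ω = a with hS
  have h : ∀ ω ∈ S, q (f ω) / fiberCard (fun ω => (f ω, g ω)) ω = q a / S.card := by
    intro ω hω
    simp only [hS, Finset.mem_filter, Finset.mem_univ, true_and] at hω
    have : fiberCard (fun ω => (f ω, g ω)) ω = S.card := by
      rw [fiberCard, hS]
      congr 1
      ext ω'
      simp [hω.1, hω.2, and_comm]
    rw [this, hω.2]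
  rw [Finset.sum_congr rfl h, Finset.sum_const, nsmul_eq_mul]
  rcases S.eq_empty_or_nonempty with h0 | h0
  · simp [h0, h₀]
  · have : (S.card : ℝ) ≠ 0 := by exact_mod_cast h0.card_pos.ne'
    rw [mul_div_cancel₀ _ this]

/-- Gibbs' inequality: the conditional entropy of `f` given `g` is at most the cross entropy with
respect to any conditional distribution `q`. -/
theorem equivocation_sub_le_crossEntropy [Fintype α] (f : Ω → α) (g : Ω → γ) (q : α → γ → ℝ)
    (h₀ : ∀ a z, 0 ≤ q a z) (h₁ : ∀ z, ∑ a, q a z ≤ 1) (hpos : ∀ ω, 0 < q (f ω) (g ω)) :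
    equivocation g - equivocation (fun ω => (f ω, g ω))
      ≤ (∑ ω, -Real.logb 2 (q (f ω) (g ω))) / Fintype.card Ω := by
  classical
  rw [equivocation, equivocation, ← sub_div]
  refine div_le_div_of_nonneg_right ?_ (Nat.cast_nonneg _)
  rw [← Finset.sum_sub_distrib, ← sub_nonpos, ← Finset.sum_sub_distrib]
  have hg (ω : Ω) : (0 : ℝ) < fiberCard g ω := by exact_mod_cast fiberCard_pos g ω
  have hfg (ω : Ω) : (0 : ℝ) < fiberCard (fun ω => (f ω, g ω)) ω := by
    exact_mod_cast fiberCard_pos _ ω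
  have hlog : 0 < Real.log 2 := Real.log_pos (by norm_num)
  -- The summand is the ratio of `q` to the true conditional probability. Expanding `fiberCard g ω`
  -- as a count and exchanging sums reduces the bound to one fibre of `g` at a time.
  have key : ∑ ω, fiberCard g ω * (q (f ω) (g ω) / fiberCard (fun ω => (f ω, g ω)) ω)
      ≤ ∑ _ω : Ω, (1 : ℝ) := by
    calc ∑ ω, fiberCard g ω * (q (f ω) (g ω) / fiberCard (fun ω => (f ω, g ω)) ω)
        = ∑ ω, ∑ ω', if g ω' = g ω then
            q (f ω) (g ω) / fiberCard (fun ω => (f ω, g ω)) ω else 0 := by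
          refine Finset.sum_congr rfl fun ω _ => ?_
          rw [← Finset.sum_filter, Finset.sum_const, nsmul_eq_mul]
          congr!
      _ = ∑ ω', ∑ ω with g ω = g ω',
            q (f ω) (g ω') / fiberCard (fun ω => (f ω, g ω)) ω := by
          rw [Finset.sum_comm]
          refine Finset.sum_congr rfl fun ω' _ => ?_
          rw [Finset.sum_filter]
          refine Finset.sum_congr rfl fun ω _ => ?_
          by_cases h : g ω = g ω'
          · simp [h]
          · simp [h, Ne.symm h]
      _ ≤ _ := Finset.sum_le_sum fun ω' _ =>
          sum_fiber_div_le_one f g (fun a => q a (g ω')) (fun a => h₀ a _) (h₁ _) (g ω')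
  -- This is log x ≤ x - 1 applied to that ratio.
  have : ∑ ω, (Real.logb 2 (fiberCard g ω) - Real.logb 2 (fiberCard (fun ω => (f ω, g ω)) ω)
        - -Real.logb 2 (q (f ω) (g ω)))
      ≤ ∑ ω, (fiberCard g ω * (q (f ω) (g ω) / fiberCard (fun ω => (f ω, g ω)) ω) - 1)
        / Real.log 2 := by
    refine Finset.sum_le_sum fun ω _ => ?_
    simp only [Real.logb]
    rw [sub_neg_eq_add, ← sub_div, ← add_div]
    refine div_le_div_of_nonneg_right ?_ hlog.le
    rw [← Real.log_div (hg ω).ne' (hfg ω).ne',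
      ← Real.log_mul (div_ne_zero (hg ω).ne' (hfg ω).ne') (hpos ω).ne']
    refine (Real.log_le_sub_one_of_pos (mul_pos (div_pos (hg ω) (hfg ω)) (hpos ω))).trans_eq ?_
    ring
  refine this.trans ?_
  rw [← Finset.sum_div, Finset.sum_sub_distrib]
  exact div_nonpos_of_nonpos_of_nonneg (by linarith) hlog.le

/-- Conditioning on more reduces entropy. -/
theorem equivocation_submodular [Fintype α] (f : Ω → α) (g : Ω → γ) (h : Ω → η) :
    equivocation (fun ω => (g ω, h ω)) - equivocation (fun ω => (f ω, (g ω, h ω)))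
      ≤ equivocation g - equivocation (fun ω => (f ω, g ω)) := by
  classical
  -- The true conditional distribution of `f` given `g`. Used as a guess that ignores `h`, its cross
  -- entropy is H(f | g). It is zero where `g` has an empty fibre, so its sums are only at most one.
  let q : α → γ → ℝ := fun a z =>
    (Finset.univ.filter fun ω => f ω = a ∧ g ω = z).card / (Finset.univ.filter fun ω => g ω = z).card
  have hq (ω : Ω) : q (f ω) (g ω) = fiberCard (fun ω => (f ω, g ω)) ω / fiberCard g ω := by
    simp only [q, fiberCard, Prod.mk.injEq]
  have hg (ω : Ω) : (0 : ℝ) < fiberCard g ω := by exact_mod_cast fiberCard_pos g ω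
  have hfg (ω : Ω) : (0 : ℝ) < fiberCard (fun ω => (f ω, g ω)) ω := by
    exact_mod_cast fiberCard_pos _ ω
  refine (equivocation_sub_le_crossEntropy f (fun ω => (g ω, h ω)) (fun a z => q a z.1)
    (fun a z => by positivity) (fun z => ?_) (fun ω => ?_)).trans_eq ?_
  · simp only [q]
    rw [← Finset.sum_div]
    refine div_le_one_of_le₀ (le_of_eq ?_) (Nat.cast_nonneg _)
    rw [← Nat.cast_sum, Finset.card_eq_sum_card_fiberwise (f := f) (t := Finset.univ)
      (fun _ _ => Finset.mem_coe.2 (Finset.mem_univ _))]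
    simp only [Finset.filter_filter, and_comm]
  · simp only [hq]
    exact div_pos (hfg ω) (hg ω)
  · rw [equivocation, equivocation, ← sub_div, ← Finset.sum_sub_distrib]
    congr 1
    refine Finset.sum_congr rfl fun ω _ => ?_
    simp only [hq]
    rw [Real.logb_div (hfg ω).ne' (hg ω).ne']
    ring

theorem neg_logb_two_le {x : ℝ} {k : ℕ} (h : (1 / 2) ^ k ≤ x) : -Real.logb 2 x ≤ k := by
  have h1 := Real.logb_le_logb_of_le (b := 2) (by norm_num) (by positivity) h
  rw [Real.logb_pow, one_div, Real.logb_inv, Real.logb_self_eq_one (by norm_num)] at h1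
  linarith

open Classical in
/-- Probability of `A` under the uniform distribution. -/
noncomputable def fraction (A : Ω → Prop) : ℝ :=
  (∑ ω, if A ω then (1 : ℝ) else 0) / Fintype.card Ω

/-- Fano's inequality. -/
theorem equivocation_fano [Nonempty Ω] {m : ℕ} (f : Ω → Bits m) (g : Ω → γ) (d : γ → Bits m) :
    equivocation g - equivocation (fun ω => (f ω, g ω))
      ≤ 1 + fraction (fun ω => d (g ω) ≠ f ω) * m := by
  classical
  have hΩ : (0 : ℝ) < Fintype.card Ω := by exact_mod_cast Fintype.card_pos
  -- The guess puts half its mass on the estimate and spreads half uniformly: a correct estimate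
  -- costs at most 1 bit, a wrong one `m + 1`.
  refine (equivocation_sub_le_crossEntropy f g
    (fun a z => (if a = d z then 1 / 2 else 0) + 1 / 2 * (1 / 2) ^ m)
    (fun a z => by positivity) (fun z => ?_) (fun ω => by positivity)).trans ?_
  · rw [Finset.sum_add_distrib]
    simp only [Finset.sum_ite_eq', Finset.mem_univ, if_true, Finset.sum_const, Finset.card_univ,
      Fintype.card_pi, ZMod.card, Finset.prod_const, Fintype.card_fin, nsmul_eq_mul]
    push_cast
    rw [mul_left_comm, ← mul_pow]
    norm_num
  · have h (S : ℝ) : 1 + S / Fintype.card Ω * m = (∑ _ω : Ω, (1 : ℝ) + S * m) / Fintype.card Ω := by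
      simp only [Finset.sum_const, Finset.card_univ, nsmul_eq_mul]
      field_simp
    rw [fraction, h, Finset.sum_mul, ← Finset.sum_add_distrib]
    refine div_le_div_of_nonneg_right ?_ hΩ.le
    refine Finset.sum_le_sum fun ω _ => ?_
    by_cases h : d (g ω) = f ω
    · simp only [h, if_true, ne_eq, not_true_eq_false, if_false, zero_mul]
      refine (neg_logb_two_le (k := 1) ?_).trans_eq (by simp)
      have : (0 : ℝ) ≤ 1 / 2 * (1 / 2) ^ m := by positivity
      linarith
    · simp only [h, Ne.symm h, if_true, ne_eq, not_false_eq_true, if_false, one_mul, zero_add]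
      refine (neg_logb_two_le (k := m + 1) ?_).trans_eq (by push_cast; ring)
      rw [pow_succ']

end Entropy

/-! ### Received positions, and submodular functions of them -/

theorem card_eq_off {ι : Type*} [Fintype ι] [DecidableEq ι] (J : Finset ι) (w : ι → ZMod 2) :
    (Finset.univ.filter fun v : ι → ZMod 2 => ∀ j ∉ J, v j = w j).card = 2 ^ J.card := by
  have : (Finset.univ.filter fun v : ι → ZMod 2 => ∀ j ∉ J, v j = w j)
      = Fintype.piFinset fun j => if j ∈ J then Finset.univ else {w j} := by
    ext v
    simp only [Finset.mem_filter, Finset.mem_univ, true_and, Fintype.mem_piFinset]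
    refine forall_congr' fun j => ?_
    by_cases h : j ∈ J <;> simp [h]
  rw [this, Fintype.card_piFinset]
  simp [apply_ite Finset.card]

/-- The positions at which a string is one. -/
def ones {n : ℕ} (s : Bits n) : Finset (Fin n) := Finset.univ.filter fun t => s t = 1

theorem mem_ones {n : ℕ} {s : Bits n} {t : Fin n} : t ∈ ones s ↔ s t = 1 := by
  simp [ones]

theorem notMem_ones {n : ℕ} {s : Bits n} {t : Fin n} : t ∉ ones s ↔ s t = 0 := by
  rw [mem_ones]
  rcases zmod_two_eq_zero_or_one (s t) with h | h <;> simp [h]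

theorem ones_mul {n : ℕ} (s t : Bits n) : ones (s * t) = (ones s).filter fun i => t i = 1 := by
  ext i
  simp only [mem_ones, Finset.mem_filter, Pi.mul_apply]
  rcases zmod_two_eq_zero_or_one (s i) with h | h <;> simp [h]

theorem mul_eq_mul_iff {n : ℕ} {s v w : Bits n} : s * v = s * w ↔ ∀ t ∈ ones s, v t = w t := by
  rw [funext_iff]
  refine forall_congr' fun t => ?_
  rw [mem_ones, Pi.mul_apply, Pi.mul_apply]
  rcases zmod_two_eq_zero_or_one (s t) with h | h <;> simp [h]

theorem card_mul_eq_mul {m : ℕ} (e w : Bits m) :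
    (Finset.univ.filter fun v : Bits m => e * v = e * w).card = 2 ^ (ones e)ᶜ.card := by
  rw [← card_eq_off _ w]
  simp [mul_eq_mul_iff]

theorem bernoulliMean_card_ones (p : ℝ) {n : ℕ} :
    bernoulliMean p (fun s : Bits n => ((ones s).card : ℝ)) = n * p := by
  have := bernoulliMean_sum_coord p (k := n) (fun x => if x = 1 then 1 else 0)
  simp only [ones, Finset.card_filter]
  push_cast
  rw [this]
  simp

theorem bernoulliMean_card_ones_compl (p : ℝ) {n : ℕ} :
    bernoulliMean p (fun s : Bits n => ((ones s)ᶜ.card : ℝ)) = n * (1 - p) := by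
  have h (s : Bits n) : ((ones s)ᶜ.card : ℝ) = n - (ones s).card := by
    rw [Finset.card_compl, Fintype.card_fin, Nat.cast_sub]
    simpa using (ones s).card_le_univ
  simp only [h, bernoulliMean_sub, bernoulliMean_const, bernoulliMean_card_ones]
  ring

/-- Insert positions one at a time. Each is kept with probability `q`, and by submodularity its gain
over the kept subset is at least its gain over the full set. -/
theorem mul_le_bernoulliMean_of_submodular {n : ℕ} {G : Finset (Fin n) → ℝ} (h₀ : 0 ≤ G ∅)
    (hG : ∀ A B i, B ⊆ A → i ∉ A → G (insert i A) - G A ≤ G (insert i B) - G B)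
    {q : ℝ} (hq₀ : 0 ≤ q) (hq₁ : q ≤ 1) (A : Finset (Fin n)) :
    q * G A ≤ bernoulliMean q fun t => G (A.filter fun i => t i = 1) := by
  classical
  induction A using Finset.induction_on with
  | empty => simpa [bernoulliMean_const] using mul_le_of_le_one_left h₀ hq₁
  | insert i A hi ih =>
    have h (t : Bits n) : G (A.filter fun i => t i = 1)
        + (if t i = 1 then 1 else 0) * (G (insert i A) - G A)
        ≤ G ((insert i A).filter fun i => t i = 1) := by
      rw [Finset.filter_insert]
      split_ifs
      · have := hG A (A.filter fun i => t i = 1) i (Finset.filter_subset _ _) hi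
        linarith
      · linarith
    refine le_trans ?_ (bernoulliMean_mono hq₀ hq₁ h)
    rw [bernoulliMean_add, bernoulliMean_mul_const,
      bernoulliMean_coord q i (fun x => if x = 1 then 1 else 0)]
    simp
    linarith

/-- The sparser of the two strings is a thinning of the denser. For q ≤ p submodularity gives the
factor q/p; for p < q monotonicity alone gives the factor 1. -/
theorem min_mul_bernoulliMean_le {n : ℕ} {G : Finset (Fin n) → ℝ} (h₀ : 0 ≤ G ∅)
    (hmono : Monotone G)
    (hG : ∀ A B i, B ⊆ A → i ∉ A → G (insert i A) - G A ≤ G (insert i B) - G B)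
    {p q : ℝ} (hp₀ : 0 < p) (hp₁ : p ≤ 1) (hq₀ : 0 ≤ q) (hq₁ : q ≤ 1) :
    min (q / p) 1 * bernoulliMean p (fun s => G (ones s)) ≤
      bernoulliMean q fun s => G (ones s) := by
  rcases le_or_gt q p with h | h
  · have h1 : q / p ≤ 1 := div_le_one_of_le₀ h hp₀.le
    have h2 : q = p * (q / p) := by field_simp
    rw [min_eq_left h1]
    conv_rhs => rw [h2, ← bernoulliMean_thinning]
    rw [← bernoulliMean_const_mul]
    refine bernoulliMean_mono hp₀.le hp₁ fun s => ?_
    simp only [ones_mul]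
    exact mul_le_bernoulliMean_of_submodular h₀ hG (by positivity) h1 _
  · have hq : 0 < q := hp₀.trans h
    have h1 : p / q ≤ 1 := div_le_one_of_le₀ h.le hq.le
    have h2 : p = q * (p / q) := by field_simp
    rw [min_eq_right ((one_le_div hp₀).2 h.le), one_mul]
    conv_lhs => rw [h2, ← bernoulliMean_thinning]
    refine bernoulliMean_mono hq₀ hq₁ fun s => ?_
    simp only [ones_mul]
    refine (bernoulliMean_mono (by positivity) h1 fun t =>
      hmono (Finset.filter_subset _ _)).trans_eq ?_
    rw [bernoulliMean_const]

/-! ### Entropy of the channel output -/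

section OutputEntropy

variable {Ω γ : Type*} [Fintype Ω] {n : ℕ}

/-- Conditional entropy given `V` of the entries of `X` at the positions in `S`. -/
noncomputable def outputEntropy (V : Ω → γ) (X : Ω → Bits n) (S : Finset (Fin n)) : ℝ :=
  equivocation V - equivocation fun ω => (fun t : S => X ω t, V ω)

theorem outputEntropy_empty (V : Ω → γ) (X : Ω → Bits n) : 0 ≤ outputEntropy V X ∅ := by
  rw [outputEntropy, sub_nonneg]
  exact equivocation_le_of_refines fun ω ω' h => (Prod.mk.inj h).2

theorem outputEntropy_mono (V : Ω → γ) (X : Ω → Bits n) : Monotone (outputEntropy V X) := by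
  intro A B hAB
  refine sub_le_sub_left (equivocation_le_of_refines fun ω ω' h => ?_) _
  simp only [Prod.mk.injEq, funext_iff, Subtype.forall] at h ⊢
  exact ⟨fun t ht => h.1 t (hAB ht), h.2⟩

/-- The gain at `i` is the entropy of that input given `V` and the earlier inputs, and `A`
conditions on more than `B`. -/
theorem outputEntropy_submodular (V : Ω → γ) (X : Ω → Bits n) (A B : Finset (Fin n)) (i : Fin n)
    (hBA : B ⊆ A) :
    outputEntropy V X (insert i A) - outputEntropy V X A
      ≤ outputEntropy V X (insert i B) - outputEntropy V X B := by
  have h := equivocation_submodular (fun ω => X ω i) (fun ω => (fun t : B => X ω t, V ω))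
    (fun ω => fun t : A => X ω t)
  have h1 : equivocation (fun ω => ((fun t : B => X ω t, V ω), fun t : A => X ω t))
      = equivocation fun ω => (fun t : A => X ω t, V ω) := by
    refine equivocation_congr fun ω ω' => ?_
    simp only [Prod.mk.injEq, funext_iff, Subtype.forall]
    exact ⟨fun h => ⟨h.2, h.1.2⟩, fun h => ⟨⟨fun t ht => h.1 t (hBA ht), h.2⟩, h.1⟩⟩
  have h2 : equivocation (fun ω => (X ω i, ((fun t : B => X ω t, V ω), fun t : A => X ω t)))
      = equivocation fun ω => (fun t : (insert i A : Finset _) => X ω t, V ω) := by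
    refine equivocation_congr fun ω ω' => ?_
    simp only [Prod.mk.injEq, funext_iff, Subtype.forall, Finset.forall_mem_insert]
    exact ⟨fun h => ⟨⟨h.1, h.2.2⟩, h.2.1.2⟩,
      fun h => ⟨h.1.1, ⟨fun t ht => h.1.2 t (hBA ht), h.2⟩, h.1.2⟩⟩
  have h3 : equivocation (fun ω => (X ω i, (fun t : B => X ω t, V ω)))
      = equivocation fun ω => (fun t : (insert i B : Finset _) => X ω t, V ω) := by
    refine equivocation_congr fun ω ω' => ?_
    simp only [Prod.mk.injEq, funext_iff, Subtype.forall, Finset.forall_mem_insert, and_assoc]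
  rw [h1, h2, h3] at h
  simp only [outputEntropy]
  linarith

theorem outputEntropy_ones (V : Ω → γ) (X : Ω → Bits n) (s : Bits n) :
    outputEntropy V X (ones s) = equivocation V - equivocation fun ω => (s * X ω, V ω) := by
  rw [outputEntropy]
  congr 1
  refine equivocation_congr fun ω ω' => ?_
  rw [Prod.mk.injEq, Prod.mk.injEq, mul_eq_mul_iff, funext_iff, Subtype.forall]

theorem outputEntropy_ones_le_card [Nonempty Ω] (V : Ω → γ) (X : Ω → Bits n) (s : Bits n) :
    outputEntropy V X (ones s) ≤ (ones s).card := by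
  rw [outputEntropy_ones]
  classical
  -- The guess is uniform on the strings that vanish at the erased positions.
  refine (equivocation_sub_le_crossEntropy (fun ω => s * X ω) V
    (fun a _ => if ∀ j ∉ ones s, a j = 0 then (1 / 2) ^ (ones s).card else 0)
    (fun a z => by positivity) (fun z => ?_) (fun ω => ?_)).trans ?_
  · rw [← Finset.sum_filter, Finset.sum_const]
    have := card_eq_off (ones s) 0
    simp only [Pi.zero_apply] at this
    rw [this, nsmul_eq_mul]
    push_cast
    rw [← mul_pow]
    norm_num
  · rw [if_pos]
    · positivity
    · intro j hj
      simp [notMem_ones.1 hj]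
  · rw [div_le_iff₀ (by exact_mod_cast Fintype.card_pos)]
    refine (Finset.sum_le_card_nsmul _ _ ((ones s).card : ℝ) fun ω _ => ?_).trans_eq ?_
    · refine neg_logb_two_le ?_
      rw [if_pos]
      intro j hj
      simp [notMem_ones.1 hj]
    · simp [mul_comm]

end OutputEntropy

/-! ### The converse -/

theorem messageFraction_eq {m₁ m₂ : ℕ} (A : Bits m₁ → Bits m₂ → Prop) :
    messageFraction A = fraction fun w : Bits m₁ × Bits m₂ => A w.1 w.2 := by
  classical
  have h : (Fintype.card (Bits m₁ × Bits m₂) : ℝ)⁻¹ = (1 / 2) ^ m₁ * (1 / 2) ^ m₂ := by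
    simp [mul_comm]
  rw [messageFraction, fraction, ← h, Fintype.sum_prod_type, div_eq_inv_mul]

/-- What receiver 2 needs to know, beyond its cache, to be as good as a decoder of both messages. -/
def genie {m₁ m₂ : ℕ} (e : Bits m₁) (w : Bits m₁ × Bits m₂) : Bits m₂ × Bits m₁ := (w.2, e * w.1)

theorem equivocation_genie {m₁ m₂ : ℕ} (e : Bits m₁) :
    equivocation (genie (m₂ := m₂) e) = ((ones e)ᶜ.card : ℕ) := by
  classical
  refine equivocation_of_card fun w => ?_
  rw [← card_mul_eq_mul e w.1, fiberCard]
  refine Finset.card_bij' (fun v _ => v.1) (fun v _ => (v, w.2)) ?_ ?_ ?_ ?_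
  all_goals simp +contextual [genie, Prod.ext_iff]

theorem equivocation_cache {m₁ m₂ : ℕ} (e : Bits m₁) :
    equivocation (fun w : Bits m₁ × Bits m₂ => e * w.1) = (ones e)ᶜ.card + m₂ := by
  classical
  have : ((ones e)ᶜ.card : ℝ) + m₂ = ((ones e)ᶜ.card + m₂ : ℕ) := by push_cast; rfl
  rw [this]
  refine equivocation_of_card fun w => ?_
  rw [pow_add, ← card_mul_eq_mul e w.1, fiberCard]
  have : (2 : ℕ) ^ m₂ = (Finset.univ : Finset (Bits m₂)).card := by simp
  rw [this, ← Finset.card_product]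
  congr 1
  ext v
  simp

/-- Chain rule: given the cache, the output entropy, at most the number of received positions, is
the information about W₂, bounded below by Fano, plus the output entropy given W₂ as well. -/
theorem receiver₂_bound {n m₁ m₂ : ℕ} (X : Bits m₁ × Bits m₂ → Bits n) (e : Bits m₁) (s : Bits n)
    (d : Bits n → Bits m₁ → Bits m₂) :
    (m₂ : ℝ) ≤ (ones s).card + 1
      + messageFraction (fun w₁ w₂ => d (s * X (w₁, w₂)) (e * w₁) ≠ w₂) * m₂
      - outputEntropy (genie e) X (ones s) := by
  classical
  have h1 := outputEntropy_ones_le_card (fun w : Bits m₁ × Bits m₂ => e * w.1) X s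
  have h2 := equivocation_fano (fun w : Bits m₁ × Bits m₂ => w.2)
    (fun w : Bits m₁ × Bits m₂ => (s * X w, e * w.1)) (fun y => d y.1 y.2)
  have h3 : equivocation (fun w : Bits m₁ × Bits m₂ => (w.2, (s * X w, e * w.1)))
      = equivocation fun w => (s * X w, genie e w) := by
    refine equivocation_congr fun ω ω' => ?_
    simp only [Prod.mk.injEq, genie]
    tauto
  rw [outputEntropy_ones, equivocation_cache] at h1
  rw [messageFraction_eq, outputEntropy_ones, equivocation_genie]
  rw [h3] at h2
  dsimp only at h1 h2 ⊢
  linarith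

/-- Given the genie's data only the uncached bits of W₁ are uncertain, and Fano forces the output to
reveal them. -/
theorem receiver₁_bound {n m₁ m₂ : ℕ} (X : Bits m₁ × Bits m₂ → Bits n) (e : Bits m₁) (s : Bits n)
    (d : Bits n → Bits m₂ → Bits m₁) :
    ((ones e)ᶜ.card : ℝ) - 1
      - messageFraction (fun w₁ w₂ => d (s * X (w₁, w₂)) w₂ ≠ w₁) * m₁
      ≤ outputEntropy (genie e) X (ones s) := by
  classical
  have h2 := equivocation_fano (fun w : Bits m₁ × Bits m₂ => w.1)
    (fun w : Bits m₁ × Bits m₂ => (s * X w, genie e w)) (fun y => d y.1 y.2.1)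
  have h3 : equivocation (fun w : Bits m₁ × Bits m₂ => (w.1, (s * X w, genie e w))) = 0 := by
    refine equivocation_of_injective fun ω ω' h => ?_
    simp only [Prod.mk.injEq, genie] at h
    exact Prod.ext h.1 h.2.2.1
  rw [messageFraction_eq, outputEntropy_ones, equivocation_genie]
  rw [h3] at h2
  simp only [genie] at h2 ⊢
  linarith

/-- The bound for receiver 1 times `τ` is added to that for receiver 2; the comparison of the two
channels removes the output entropies. -/
theorem Code.converse {n m₁ m₂ : ℕ} (c : Code n m₁ m₂) (P : Params)
    (hδ₁ : 0 ≤ P.δ₁ ∧ P.δ₁ < 1) (hδ₂ : 0 ≤ P.δ₂ ∧ P.δ₂ < 1)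
    (hε₁ : 0 ≤ P.ε₁ ∧ P.ε₁ ≤ 1) (hε₂ : 0 ≤ P.ε₂ ∧ P.ε₂ ≤ 1) :
    P.β₁ * m₁ + m₂ ≤ n * (1 - P.δ₂) + 1 + c.error₂ P * m₂
      + min ((1 - P.δ₂) / (1 - P.δ₁)) 1 * (1 + c.error₁ P * m₁) := by
  set τ := min ((1 - P.δ₂) / (1 - P.δ₁)) 1 with hτ
  have hτ₀ : 0 ≤ τ := le_min (div_nonneg (by linarith) (by linarith)) zero_le_one
  have key (e₁ : Bits m₂) (e₂ : Bits m₁) :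
      τ * ((ones e₂)ᶜ.card : ℝ) + m₂ ≤ n * (1 - P.δ₂) + 1
        + bernoulliMean (1 - P.δ₂) (fun s => messageFraction fun w₁ w₂ =>
            c.decode₂ (s * c.encode w₁ w₂ e₁ e₂) s e₁ e₂ (e₂ * w₁) ≠ w₂) * m₂
        + τ * (1 + bernoulliMean (1 - P.δ₁) (fun s => messageFraction fun w₁ w₂ =>
            c.decode₁ (s * c.encode w₁ w₂ e₁ e₂) s e₁ e₂ (e₁ * w₂) ≠ w₁) * m₁) := by
    let X : Bits m₁ × Bits m₂ → Bits n := fun w => c.encode w.1 w.2 e₁ e₂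
    have h2 := bernoulliMean_mono (p := 1 - P.δ₂) (by linarith) (by linarith) fun s =>
      receiver₂_bound X e₂ s fun y u => c.decode₂ y s e₁ e₂ u
    -- The genie supplies all of W₂; the decoder uses only its cached part.
    have h1 := bernoulliMean_mono (p := 1 - P.δ₁) (by linarith) (by linarith) fun s =>
      receiver₁_bound X e₂ s fun y u => c.decode₁ y s e₁ e₂ (e₁ * u)
    simp only [bernoulliMean_add, bernoulliMean_sub, bernoulliMean_const, bernoulliMean_mul_const,
      bernoulliMean_card_ones] at h1 h2
    have h3 := min_mul_bernoulliMean_le (p := 1 - P.δ₁) (q := 1 - P.δ₂)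
      (outputEntropy_empty (genie e₂) X) (outputEntropy_mono _ _)
      (fun A B i h _ => outputEntropy_submodular (genie e₂) X A B i h)
      (by linarith) (by linarith) (by linarith) (by linarith)
    have h4 := mul_le_mul_of_nonneg_left h1 hτ₀
    rw [← hτ] at h3
    simp only [X] at h1 h2 h3 h4
    linarith
  have := bernoulliMean_mono (p := 1 - P.ε₁) (by linarith) (by linarith) fun e₁ =>
    bernoulliMean_mono (p := 1 - P.ε₂) (by linarith) (by linarith) fun e₂ => key e₁ e₂
  simp only [bernoulliMean_add, bernoulliMean_const, bernoulliMean_mul_const,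
    bernoulliMean_const_mul, bernoulliMean_card_ones_compl] at this
  rw [Code.error₁_eq, Code.error₂_eq, Params.β₁, ← hτ]
  linarith

theorem tendsto_ceil_mul_div {x : ℝ} (hx : 0 ≤ x) :
    Tendsto (fun n : ℕ => (⌈(n : ℝ) * x⌉₊ : ℝ) / n) atTop (𝓝 x) := by
  have := (tendsto_nat_ceil_mul_div_atTop hx).comp (tendsto_natCast_atTop_atTop (R := ℝ))
  refine this.congr fun n => ?_
  simp [mul_comm]

theorem Achievable.bound₂ {P : Params} {R : ℝ × ℝ} (h : Achievable P R)
    (hδ₁ : 0 ≤ P.δ₁ ∧ P.δ₁ < 1) (hδ₂ : 0 ≤ P.δ₂ ∧ P.δ₂ < 1)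
    (hε₁ : 0 ≤ P.ε₁ ∧ P.ε₁ ≤ 1) (hε₂ : 0 ≤ P.ε₂ ∧ P.ε₂ ≤ 1) :
    P.β₁ * R.1 + R.2 ≤ 1 - P.δ₂ := by
  obtain ⟨hR₁, hR₂, c, hc₁, hc₂⟩ := h
  set τ := min ((1 - P.δ₂) / (1 - P.δ₁)) 1 with hτ
  have hτ₀ : 0 ≤ τ := le_min (div_nonneg (by linarith) (by linarith)) zero_le_one
  have hβ : P.β₁ = P.ε₂ * τ := rfl
  have hβ₀ : 0 ≤ P.β₁ := mul_nonneg hε₂.1 hτ₀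
  have hn : Tendsto (fun n : ℕ => 1 / (n : ℝ)) atTop (𝓝 0) := tendsto_one_div_atTop_nhds_zero_nat
  have hl := ((tendsto_ceil_mul_div hR₁).const_mul P.β₁).add (tendsto_ceil_mul_div hR₂)
  have hr := ((hn.const_add (1 - P.δ₂)).add (hc₂.mul (tendsto_ceil_mul_div hR₂))).add
    ((hn.add (hc₁.mul (tendsto_ceil_mul_div hR₁))).const_mul τ)
  simp only [zero_mul, add_zero, mul_zero] at hr
  refine le_of_tendsto_of_tendsto hl hr ?_
  filter_upwards [eventually_gt_atTop 0] with n hn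
  have hn' : (0 : ℝ) < n := by exact_mod_cast hn
  have := div_le_div_of_nonneg_right ((c n).converse P hδ₁ hδ₂ hε₁ hε₂) hn'.le
  rw [← hτ] at this
  convert this using 1
  · ring
  · field_simp

/-! ### Random linear equations -/

section Fraction

variable {Ω : Type*} [Fintype Ω]

theorem fraction_eq_card (A : Ω → Prop) [DecidablePred A] :
    fraction A = (Finset.univ.filter A).card / Fintype.card Ω := by
  rw [fraction, Finset.natCast_card_filter]
  congr!

theorem fraction_mono {A B : Ω → Prop} (h : ∀ ω, A ω → B ω) : fraction A ≤ fraction B := by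
  classical
  refine div_le_div_of_nonneg_right (Finset.sum_le_sum fun ω _ => ?_) (Nat.cast_nonneg _)
  by_cases hA : A ω
  · simp [hA, h ω hA]
  · simp only [hA, if_false]
    positivity

theorem fraction_le_one (A : Ω → Prop) : fraction A ≤ 1 := by
  classical
  refine div_le_one_of_le₀ ?_ (Nat.cast_nonneg _)
  refine (Finset.sum_le_card_nsmul _ _ (1 : ℝ) fun ω _ => ?_).trans_eq (by simp)
  split_ifs <;> norm_num

theorem fraction_exists_le {α : Type*} (D : Finset α) (A : α → Ω → Prop) :
    fraction (fun ω => ∃ v ∈ D, A v ω) ≤ ∑ v ∈ D, fraction (A v) := by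
  classical
  simp only [fraction]
  rw [← Finset.sum_div, Finset.sum_comm]
  refine div_le_div_of_nonneg_right (Finset.sum_le_sum fun ω _ => ?_) (Nat.cast_nonneg _)
  split_ifs with h
  · obtain ⟨v, hv, hA⟩ := h
    refine le_trans ?_ (Finset.single_le_sum (fun v _ => by positivity) hv)
    simp [hA]
  · exact Finset.sum_nonneg fun v _ => by positivity

end Fraction

/-- Flipping the entry of `g` at a position where `v` is one flips the product, pairing zeros with
ones. -/
theorem card_dotProduct_eq_zero {ι : Type*} [Fintype ι] [DecidableEq ι] {v : ι → ZMod 2}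
    (hv : v ≠ 0) :
    2 * (Finset.univ.filter fun g : ι → ZMod 2 => g ⬝ᵥ v = 0).card
      = Fintype.card (ι → ZMod 2) := by
  obtain ⟨i, hi⟩ := Function.ne_iff.1 hv
  have hi : v i = 1 := (zmod_two_eq_zero_or_one _).resolve_left hi
  have h : (Finset.univ.filter fun g : ι → ZMod 2 => g ⬝ᵥ v = 0).card
      = (Finset.univ.filter fun g : ι → ZMod 2 => ¬g ⬝ᵥ v = 0).card := by
    refine Finset.card_equiv (Equiv.addRight (Pi.single i 1)) fun g => ?_
    simp only [Finset.mem_filter, Finset.mem_univ, true_and, Equiv.coe_addRight, add_dotProduct,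
      single_dotProduct, hi, mul_one]
    rcases zmod_two_eq_zero_or_one (g ⬝ᵥ v) with h | h <;> rw [h] <;> decide
  rw [← Finset.card_univ, ← Finset.card_filter_add_card_filter_not
    (s := Finset.univ) (fun g : ι → ZMod 2 => g ⬝ᵥ v = 0)]
  omega

theorem fraction_forall_dotProduct {ι : Type*} [Fintype ι] [DecidableEq ι] {n : ℕ} {v : ι → ZMod 2} (hv : v ≠ 0)
    (T : Finset (Fin n)) :
    fraction (fun G : Fin n → ι → ZMod 2 => ∀ t ∈ T, G t ⬝ᵥ v = 0) = (1 / 2) ^ T.card := by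
  classical
  have h : (Finset.univ.filter fun G : Fin n → ι → ZMod 2 => ∀ t ∈ T, G t ⬝ᵥ v = 0)
      = Fintype.piFinset fun t => if t ∈ T then
          Finset.univ.filter fun g : ι → ZMod 2 => g ⬝ᵥ v = 0 else Finset.univ := by
    ext G
    simp only [Finset.mem_filter, Finset.mem_univ, true_and, Fintype.mem_piFinset]
    refine forall_congr' fun t => ?_
    by_cases ht : t ∈ T <;> simp [ht]
  have h2 : ((Finset.univ.filter fun g : ι → ZMod 2 => g ⬝ᵥ v = 0).card : ℝ)
      / Fintype.card (ι → ZMod 2) = 1 / 2 := by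
    have := card_dotProduct_eq_zero hv
    have hpos : (Fintype.card (ι → ZMod 2) : ℝ) ≠ 0 := by exact_mod_cast Fintype.card_ne_zero
    rw [div_eq_iff hpos, ← this]
    push_cast
    ring
  have h3 : (Fintype.card (Fin n → ι → ZMod 2) : ℝ)
      = ∏ _t : Fin n, (Fintype.card (ι → ZMod 2) : ℝ) := by
    rw [Fintype.card_pi]
    push_cast
    rfl
  rw [fraction_eq_card, h, Fintype.card_piFinset, h3]
  push_cast
  rw [← Finset.prod_div_distrib]
  have h4 (t : Fin n) : (((if t ∈ T then Finset.univ.filter fun g : ι → ZMod 2 => g ⬝ᵥ v = 0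
      else Finset.univ : Finset (ι → ZMod 2)).card : ℝ)) / Fintype.card (ι → ZMod 2)
      = if t ∈ T then 1 / 2 else 1 := by
    have hpos : (Fintype.card (ι → ZMod 2) : ℝ) ≠ 0 := by exact_mod_cast Fintype.card_ne_zero
    split_ifs
    · exact h2
    · rw [Finset.card_univ, div_self hpos]
  simp only [h4]
  simp

/-- The rows of `G` indexed by `T` do not determine the entries at positions in `J`. -/
def Ambiguous {ι : Type*} [Fintype ι] {n : ℕ} (J : Finset ι) (T : Finset (Fin n))
    (G : Fin n → ι → ZMod 2) : Prop :=
  ∃ v : ι → ZMod 2, v ≠ 0 ∧ (∀ j ∉ J, v j = 0) ∧ ∀ t ∈ T, G t ⬝ᵥ v = 0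

/-- Replaces the capped union bound min(1, 2^(a - b)) by y^(a - b), using y ≥ 1 if a ≥ b and y ≤ 2
otherwise. The free base serves as a Chernoff parameter, and the powers average exactly over
Bernoulli strings. -/
theorem le_pow_mul_inv_pow {x y : ℝ} {a b : ℕ} (h₁ : x ≤ 1) (h₂ : x ≤ 2 ^ a * (1 / 2) ^ b)
    (hy₁ : 1 ≤ y) (hy₂ : y ≤ 2) : x ≤ y ^ a * (1 / y) ^ b := by
  have hy : y ≠ 0 := by positivity
  rcases le_total b a with h | h
  · obtain ⟨c, rfl⟩ := Nat.exists_eq_add_of_le h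
    rw [pow_add, mul_right_comm, ← mul_pow, mul_one_div_cancel hy, one_pow, one_mul]
    exact h₁.trans (one_le_pow₀ hy₁)
  · obtain ⟨c, rfl⟩ := Nat.exists_eq_add_of_le h
    rw [pow_add, ← mul_assoc, ← mul_pow] at h₂ ⊢
    rw [mul_one_div_cancel hy, one_pow, one_mul]
    rw [mul_one_div_cancel (by norm_num), one_pow, one_mul] at h₂
    refine h₂.trans (pow_le_pow_left₀ (by norm_num) ?_ c)
    exact one_div_le_one_div_of_le (by linarith) hy₂

/-- Union bound over at most 2^|J| vectors, each killed by all rows in `T` with probability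
2^(-|T|). -/
theorem fraction_ambiguous_le {ι : Type*} [Fintype ι] [DecidableEq ι] {n : ℕ} (J : Finset ι)
    (T : Finset (Fin n))
    {y : ℝ} (hy₁ : 1 ≤ y) (hy₂ : y ≤ 2) :
    fraction (Ambiguous J T) ≤ y ^ J.card * (1 / y) ^ T.card := by
  classical
  refine le_pow_mul_inv_pow (fraction_le_one _) ?_ hy₁ hy₂
  let D : Finset (ι → ZMod 2) := Finset.univ.filter fun v => ∀ j ∉ J, v j = 0
  have hD : D.card = 2 ^ J.card := card_eq_off J 0
  calc fraction (Ambiguous J T)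
      ≤ fraction fun G : Fin n → ι → ZMod 2 =>
          ∃ v ∈ D.filter (· ≠ 0), ∀ t ∈ T, G t ⬝ᵥ v = 0 := by
        refine fraction_mono fun G ⟨v, hv, hJ, hT⟩ => ⟨v, ?_, hT⟩
        simpa [D, hv] using hJ
    _ ≤ ∑ v ∈ D.filter (· ≠ 0),
          fraction fun G : Fin n → ι → ZMod 2 => ∀ t ∈ T, G t ⬝ᵥ v = 0 :=
        fraction_exists_le _ _
    _ = ∑ v ∈ D.filter (· ≠ 0), (1 / 2) ^ T.card :=
        Finset.sum_congr rfl fun v hv => fraction_forall_dotProduct (Finset.mem_filter.1 hv).2 T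
    _ ≤ 2 ^ J.card * (1 / 2) ^ T.card := by
        rw [Finset.sum_const, nsmul_eq_mul]
        refine mul_le_mul_of_nonneg_right ?_ (by positivity)
        exact_mod_cast (Finset.card_filter_le _ _).trans_eq hD

/-! ### The two-phase linear code -/

/-- The generator of a linear code with `n` channel uses. -/
abbrev Generator (n m₁ m₂ : ℕ) : Type := Fin n → Fin m₁ ⊕ Fin m₂ → ZMod 2

/-- The message bits that are sent at time `t`: before time `k` those intended for receiver 1 that
are missing from the cache of receiver 2, and later all others. -/
def phaseMask {n m₁ m₂ : ℕ} (k : ℕ) (e₂ : Bits m₁) (t : Fin n) : Fin m₁ ⊕ Fin m₂ → ZMod 2 :=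
  if (t : ℕ) < k then Sum.elim (1 - e₂) 0 else Sum.elim e₂ 1

/-- The channel input of the two-phase linear code. -/
def linearEncode {n m₁ m₂ : ℕ} (k : ℕ) (G : Generator n m₁ m₂) (w₁ : Bits m₁) (w₂ : Bits m₂)
    (e₂ : Bits m₁) : Bits n :=
  fun t => G t ⬝ᵥ (phaseMask k e₂ t * Sum.elim w₁ w₂)

open Classical in
/-- The two-phase linear code in which each receiver picks any message that is consistent with its
observations. -/
noncomputable def linearCode {n m₁ m₂ : ℕ} (k : ℕ) (G : Generator n m₁ m₂) : Code n m₁ m₂ where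
  encode w₁ w₂ _ e₂ := linearEncode k G w₁ w₂ e₂
  decode₁ y s e₁ e₂ u :=
    if h : ∃ w₁ w₂, e₁ * w₂ = u ∧ s * linearEncode k G w₁ w₂ e₂ = y then h.choose else 0
  decode₂ y s _ e₂ u :=
    if h : ∃ w₂ w₁, e₂ * w₁ = u ∧ s * linearEncode k G w₁ w₂ e₂ = y then h.choose else 0

theorem exists_of_decode₁_ne {n m₁ m₂ : ℕ} {k : ℕ} {G : Generator n m₁ m₂} {w₁ : Bits m₁}
    {w₂ e₁ : Bits m₂} {e₂ : Bits m₁} {s : Bits n}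
    (h : (linearCode k G).decode₁ (s * (linearCode k G).encode w₁ w₂ e₁ e₂) s e₁ e₂ (e₁ * w₂)
      ≠ w₁) :
    ∃ v₁ v₂, v₁ ≠ w₁ ∧ e₁ * v₂ = e₁ * w₂ ∧
      s * linearEncode k G v₁ v₂ e₂ = s * linearEncode k G w₁ w₂ e₂ := by
  -- The true messages are consistent, so the default value 0 is never used.
  have hex : ∃ v₁ v₂, e₁ * v₂ = e₁ * w₂ ∧
      s * linearEncode k G v₁ v₂ e₂ = s * linearEncode k G w₁ w₂ e₂ := ⟨w₁, w₂, rfl, rfl⟩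
  obtain ⟨v₂, hv⟩ := hex.choose_spec
  refine ⟨hex.choose, v₂, ?_, hv⟩
  simpa only [linearCode, dif_pos hex] using h

theorem exists_of_decode₂_ne {n m₁ m₂ : ℕ} {k : ℕ} {G : Generator n m₁ m₂} {w₁ : Bits m₁}
    {w₂ e₁ : Bits m₂} {e₂ : Bits m₁} {s : Bits n}
    (h : (linearCode k G).decode₂ (s * (linearCode k G).encode w₁ w₂ e₁ e₂) s e₁ e₂ (e₂ * w₁)
      ≠ w₂) :
    ∃ v₂ v₁, v₂ ≠ w₂ ∧ e₂ * v₁ = e₂ * w₁ ∧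
      s * linearEncode k G v₁ v₂ e₂ = s * linearEncode k G w₁ w₂ e₂ := by
  have hex : ∃ v₂ v₁, e₂ * v₁ = e₂ * w₁ ∧
      s * linearEncode k G v₁ v₂ e₂ = s * linearEncode k G w₁ w₂ e₂ := ⟨w₂, w₁, rfl, rfl⟩
  obtain ⟨v₁, hv⟩ := hex.choose_spec
  refine ⟨hex.choose, v₁, ?_, hv⟩
  simpa only [linearCode, dif_pos hex] using h

theorem dotProduct_phaseMask_sub {n m₁ m₂ : ℕ} {k : ℕ} {G : Generator n m₁ m₂} {v₁ w₁ : Bits m₁}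
    {v₂ w₂ : Bits m₂} {e₂ : Bits m₁} {s : Bits n}
    (h : s * linearEncode k G v₁ v₂ e₂ = s * linearEncode k G w₁ w₂ e₂) {t : Fin n}
    (ht : t ∈ ones s) :
    G t ⬝ᵥ (phaseMask k e₂ t * Sum.elim (v₁ - w₁) (v₂ - w₂)) = 0 := by
  have h1 := mul_eq_mul_iff.1 h t ht
  rw [linearEncode, linearEncode, ← sub_eq_zero, ← dotProduct_sub, ← mul_sub] at h1
  have h2 : Sum.elim v₁ v₂ - Sum.elim w₁ w₂ = Sum.elim (v₁ - w₁) (v₂ - w₂) := by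
    ext (j | j) <;> simp
  rwa [h2] at h1

/-- If the wrong W₁ differs at a bit that receiver 2 lacks, phase one is ambiguous. Otherwise those
bits agree, and phase two cannot separate the rest of W₁ together with the uncached bits of W₂. -/
theorem ambiguous_of_decode₁_ne {n m₁ m₂ : ℕ} {k : ℕ} {G : Generator n m₁ m₂} {w₁ : Bits m₁}
    {w₂ e₁ : Bits m₂} {e₂ : Bits m₁} {s : Bits n}
    (h : (linearCode k G).decode₁ (s * (linearCode k G).encode w₁ w₂ e₁ e₂) s e₁ e₂ (e₁ * w₂)
      ≠ w₁) :
    Ambiguous ((ones e₂)ᶜ.disjSum ∅) ((ones s).filter fun t => (t : ℕ) < k) G ∨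
      Ambiguous ((ones e₂).disjSum (ones e₁)ᶜ) ((ones s).filter fun t => ¬(t : ℕ) < k) G := by
  obtain ⟨v₁, v₂, hne, hc, hs⟩ := exists_of_decode₁_ne h
  have hd := fun t => dotProduct_phaseMask_sub hs (t := t)
  by_cases h0 : (1 - e₂) * (v₁ - w₁) = 0
  · right
    refine ⟨Sum.elim (e₂ * (v₁ - w₁)) (v₂ - w₂), fun h1 => hne ?_, ?_, ?_⟩
    · have h2 : e₂ * (v₁ - w₁) = 0 := funext fun j => congrFun h1 (Sum.inl j)
      rw [sub_mul, one_mul, h2, sub_zero] at h0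
      exact sub_eq_zero.1 h0
    · rintro (j | j) hj
      · simp only [Finset.inl_mem_disjSum, notMem_ones] at hj
        simp [hj]
      · simp only [Finset.inr_mem_disjSum, Finset.mem_compl, not_not] at hj
        simp [mul_eq_mul_iff.1 hc j hj]
    · intro t ht
      rw [Finset.mem_filter] at ht
      rw [← hd t ht.1, phaseMask, if_neg ht.2]
      congr 1
      ext (j | j) <;> simp
  · left
    refine ⟨Sum.elim ((1 - e₂) * (v₁ - w₁)) 0,
      fun h1 => h0 (funext fun j => congrFun h1 (Sum.inl j)), ?_, ?_⟩
    · rintro (j | j) hj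
      · simp only [Finset.inl_mem_disjSum, Finset.mem_compl, not_not, mem_ones] at hj
        simp [hj]
      · simp
    · intro t ht
      rw [Finset.mem_filter] at ht
      rw [← hd t ht.1, phaseMask, if_pos ht.2]
      congr 1
      ext (j | j) <;> simp

/-- In phase two only bits of W₁ cached at receiver 2 appear; they cancel in the difference, leaving
W₂ alone. -/
theorem ambiguous_of_decode₂_ne {n m₁ m₂ : ℕ} {k : ℕ} {G : Generator n m₁ m₂} {w₁ : Bits m₁}
    {w₂ e₁ : Bits m₂} {e₂ : Bits m₁} {s : Bits n}
    (h : (linearCode k G).decode₂ (s * (linearCode k G).encode w₁ w₂ e₁ e₂) s e₁ e₂ (e₂ * w₁)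
      ≠ w₂) :
    Ambiguous (Finset.disjSum ∅ Finset.univ) ((ones s).filter fun t => ¬(t : ℕ) < k) G := by
  obtain ⟨v₂, v₁, hne, hc, hs⟩ := exists_of_decode₂_ne h
  have hd := fun t => dotProduct_phaseMask_sub hs (t := t)
  refine ⟨Sum.elim 0 (v₂ - w₂), fun h1 => hne ?_, ?_, ?_⟩
  · exact sub_eq_zero.1 (funext fun j => congrFun h1 (Sum.inr j))
  · rintro (j | j) hj
    · simp
    · simp at hj
  · intro t ht
    rw [Finset.mem_filter] at ht
    rw [← hd t ht.1, phaseMask, if_neg ht.2]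
    congr 1
    ext (j | j)
    · have := congrFun hc j
      simp only [Pi.mul_apply] at this
      simp [mul_sub, this]
    · simp

theorem messageFraction_le_indicator {m₁ m₂ : ℕ} {A : Bits m₁ → Bits m₂ → Prop} {Q : Prop}
    [Decidable Q] (h : ∀ w₁ w₂, A w₁ w₂ → Q) : messageFraction A ≤ if Q then 1 else 0 := by
  rw [messageFraction_eq]
  split_ifs with hQ
  · exact fraction_le_one _
  · have (w : Bits m₁ × Bits m₂) : ¬A w.1 w.2 := fun hA => hQ (h _ _ hA)
    simp [fraction, this]

/-! ### Random coding bound -/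

/-- Average over all points of a finite type. -/
noncomputable def average {Ω : Type*} [Fintype Ω] (f : Ω → ℝ) : ℝ := (∑ ω, f ω) / Fintype.card Ω

open Classical in
theorem fraction_eq_average {Ω : Type*} [Fintype Ω] (A : Ω → Prop) :
    fraction A = average fun ω => if A ω then 1 else 0 :=
  rfl

theorem average_bernoulliMean {Ω : Type*} [Fintype Ω] (p : ℝ) {k : ℕ} (f : Ω → Bits k → ℝ) :
    average (fun ω => bernoulliMean p (f ω)) = bernoulliMean p fun s => average fun ω => f ω s := by
  simp only [average, div_eq_mul_inv, bernoulliMean_mul_const, bernoulliMean_sum]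

theorem average_mono {Ω : Type*} [Fintype Ω] {f g : Ω → ℝ} (h : ∀ ω, f ω ≤ g ω) :
    average f ≤ average g :=
  div_le_div_of_nonneg_right (Finset.sum_le_sum fun ω _ => h ω) (Nat.cast_nonneg _)

theorem average_add {Ω : Type*} [Fintype Ω] (f g : Ω → ℝ) :
    average (fun ω => f ω + g ω) = average f + average g := by
  simp [average, Finset.sum_add_distrib, add_div]

theorem exists_le_average {Ω : Type*} [Fintype Ω] [Nonempty Ω] (f : Ω → ℝ) :
    ∃ ω, f ω ≤ average f := by
  by_contra! h
  have h1 : (0 : ℝ) < Fintype.card Ω := by exact_mod_cast Fintype.card_pos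
  have h2 := Finset.sum_lt_sum_of_nonempty (s := Finset.univ) Finset.univ_nonempty
    fun ω _ => h ω
  rw [Finset.sum_const, Finset.card_univ, nsmul_eq_mul, average, mul_div_cancel₀ _ h1.ne'] at h2
  exact lt_irrefl _ h2

theorem bernoulliMean_pow_card_filter (p z : ℝ) {k : ℕ} (Q : Fin k → Prop) [DecidablePred Q] :
    bernoulliMean p (fun s => z ^ ((ones s).filter Q).card)
      = (1 + p * (z - 1)) ^ (Finset.univ.filter Q).card := by
  have h := bernoulliMean_prod p (fun (t : Fin k) x => if x = 1 ∧ Q t then z else 1)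
  have h1 (s : Bits k) : (∏ t, if s t = 1 ∧ Q t then z else 1) = z ^ ((ones s).filter Q).card := by
    rw [ones, Finset.filter_filter, Finset.prod_ite]
    simp
  simp only [h1] at h
  rw [h, ← Finset.prod_const, Finset.prod_filter]
  refine Finset.prod_congr rfl fun t _ => ?_
  by_cases hQ : Q t <;> simp [hQ]
  ring

theorem bernoulliMean_pow_card (p z : ℝ) {k : ℕ} :
    bernoulliMean p (fun s : Bits k => z ^ (ones s).card) = (1 + p * (z - 1)) ^ k := by
  have := bernoulliMean_pow_card_filter p z (k := k) fun _ => True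
  simpa using this

theorem bernoulliMean_pow_card_compl (p z : ℝ) {k : ℕ} :
    bernoulliMean p (fun s : Bits k => z ^ (ones s)ᶜ.card) = (1 + (1 - p) * (z - 1)) ^ k := by
  have h := bernoulliMean_prod p (fun (_ : Fin k) x => if x = 1 then 1 else z)
  have h1 (s : Bits k) : (∏ t, if s t = 1 then 1 else z) = z ^ (ones s)ᶜ.card := by
    rw [ones, Finset.prod_ite, ← Finset.compl_filter]
    simp
  simp only [h1] at h
  rw [h]
  simp
  ring

theorem one_add_pow_le_exp {x : ℝ} (hx : -1 ≤ x) (m : ℕ) : (1 + x) ^ m ≤ Real.exp (m * x) := by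
  rw [Real.exp_nat_mul]
  refine pow_le_pow_left₀ (by linarith) ?_ m
  linarith [Real.add_one_le_exp x]

theorem average_error₁_le {n m₁ m₂ : ℕ} (P : Params) (k : ℕ)
    (hδ₁ : 0 ≤ P.δ₁ ∧ P.δ₁ < 1) (hε₁ : 0 ≤ P.ε₁ ∧ P.ε₁ ≤ 1) (hε₂ : 0 ≤ P.ε₂ ∧ P.ε₂ ≤ 1)
    {y : ℝ} (hy₁ : 1 ≤ y) (hy₂ : y ≤ 2) :
    average (fun G : Generator n m₁ m₂ => (linearCode k G).error₁ P) ≤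
      (1 + P.ε₂ * (y - 1)) ^ m₁ * (1 + (1 - P.δ₁) * (1 / y - 1)) ^
          (Finset.univ.filter fun t : Fin n => (t : ℕ) < k).card +
        (1 + (1 - P.ε₂) * (y - 1)) ^ m₁ * (1 + P.ε₁ * (y - 1)) ^ m₂ *
          (1 + (1 - P.δ₁) * (1 / y - 1)) ^
            (Finset.univ.filter fun t : Fin n => ¬(t : ℕ) < k).card := by
  classical
  simp only [Code.error₁_eq, average_bernoulliMean]
  have key (e₁ : Bits m₂) (e₂ : Bits m₁) (s : Bits n) :
      average (fun G : Generator n m₁ m₂ => messageFraction fun w₁ w₂ =>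
        (linearCode k G).decode₁ (s * (linearCode k G).encode w₁ w₂ e₁ e₂) s e₁ e₂ (e₁ * w₂) ≠ w₁)
      ≤ y ^ (ones e₂)ᶜ.card * (1 / y) ^ ((ones s).filter fun t : Fin n => (t : ℕ) < k).card
        + y ^ (ones e₂).card * y ^ (ones e₁)ᶜ.card *
          (1 / y) ^ ((ones s).filter fun t : Fin n => ¬(t : ℕ) < k).card := by
    have h1 := fraction_ambiguous_le ((ones e₂)ᶜ.disjSum (∅ : Finset (Fin m₂)))
      ((ones s).filter fun t : Fin n => (t : ℕ) < k) hy₁ hy₂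
    have h2 := fraction_ambiguous_le ((ones e₂).disjSum (ones e₁)ᶜ)
      ((ones s).filter fun t : Fin n => ¬(t : ℕ) < k) hy₁ hy₂
    rw [Finset.card_disjSum, Finset.card_empty, add_zero] at h1
    rw [Finset.card_disjSum, pow_add] at h2
    refine le_trans ?_ (add_le_add h1 h2)
    rw [fraction_eq_average, fraction_eq_average, ← average_add]
    refine average_mono fun G => ?_
    refine (messageFraction_le_indicator fun w₁ w₂ h => ambiguous_of_decode₁_ne h).trans ?_
    split_ifs <;> first | tauto | norm_num
  refine (bernoulliMean_mono (by linarith) (by linarith) fun e₁ =>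
    bernoulliMean_mono (by linarith) (by linarith) fun e₂ =>
    bernoulliMean_mono (by linarith) (by linarith) fun s => key e₁ e₂ s).trans_eq ?_
  simp only [bernoulliMean_add, bernoulliMean_const_mul, bernoulliMean_mul_const,
    bernoulliMean_const, bernoulliMean_pow_card_filter, bernoulliMean_pow_card,
    bernoulliMean_pow_card_compl, sub_sub_cancel]

theorem average_error₂_le {n m₁ m₂ : ℕ} (P : Params) (k : ℕ)
    (hδ₂ : 0 ≤ P.δ₂ ∧ P.δ₂ < 1) (hε₁ : 0 ≤ P.ε₁ ∧ P.ε₁ ≤ 1) (hε₂ : 0 ≤ P.ε₂ ∧ P.ε₂ ≤ 1)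
    {y : ℝ} (hy₁ : 1 ≤ y) (hy₂ : y ≤ 2) :
    average (fun G : Generator n m₁ m₂ => (linearCode k G).error₂ P) ≤
      y ^ m₂ * (1 + (1 - P.δ₂) * (1 / y - 1)) ^
          (Finset.univ.filter fun t : Fin n => ¬(t : ℕ) < k).card := by
  classical
  simp only [Code.error₂_eq, average_bernoulliMean]
  have key (e₁ : Bits m₂) (e₂ : Bits m₁) (s : Bits n) :
      average (fun G : Generator n m₁ m₂ => messageFraction fun w₁ w₂ =>
        (linearCode k G).decode₂ (s * (linearCode k G).encode w₁ w₂ e₁ e₂) s e₁ e₂ (e₂ * w₁) ≠ w₂)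
      ≤ y ^ m₂ * (1 / y) ^ ((ones s).filter fun t : Fin n => ¬(t : ℕ) < k).card := by
    have h1 := fraction_ambiguous_le (Finset.disjSum (∅ : Finset (Fin m₁))
      (Finset.univ : Finset (Fin m₂))) ((ones s).filter fun t : Fin n => ¬(t : ℕ) < k) hy₁ hy₂
    rw [Finset.card_disjSum, Finset.card_empty, zero_add, Finset.card_univ, Fintype.card_fin] at h1
    rw [fraction_eq_average] at h1
    refine le_trans (average_mono fun G => ?_) h1
    exact messageFraction_le_indicator fun w₁ w₂ h => ambiguous_of_decode₂_ne h
  refine (bernoulliMean_mono (by linarith) (by linarith) fun e₁ =>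
    bernoulliMean_mono (by linarith) (by linarith) fun e₂ =>
    bernoulliMean_mono (by linarith) (by linarith) fun s => key e₁ e₂ s).trans_eq ?_
  simp only [bernoulliMean_const_mul, bernoulliMean_const, bernoulliMean_pow_card_filter]

theorem card_filter_val_lt {n k : ℕ} (h : k ≤ n) :
    (Finset.univ.filter fun t : Fin n => (t : ℕ) < k).card = k := by
  rw [Fin.card_filter_val_lt, min_eq_right h]

theorem card_filter_not_val_lt {n k : ℕ} (h : k ≤ n) :
    (Finset.univ.filter fun t : Fin n => ¬(t : ℕ) < k).card = n - k := by
  rw [← Finset.compl_filter, Finset.card_compl, card_filter_val_lt h, Fintype.card_fin]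

/-- Random coding bound for the two-phase scheme. -/
theorem exists_code {n m₁ m₂ k : ℕ} (hk : k ≤ n) (P : Params)
    (hδ₁ : 0 ≤ P.δ₁ ∧ P.δ₁ < 1) (hδ₂ : 0 ≤ P.δ₂ ∧ P.δ₂ < 1)
    (hε₁ : 0 ≤ P.ε₁ ∧ P.ε₁ ≤ 1) (hε₂ : 0 ≤ P.ε₂ ∧ P.ε₂ ≤ 1)
    {y : ℝ} (hy₁ : 1 ≤ y) (hy₂ : y ≤ 2) :
    ∃ c : Code n m₁ m₂, c.error₁ P + c.error₂ P ≤
      Real.exp (m₁ * (P.ε₂ * (y - 1)) + k * ((1 - P.δ₁) * (1 / y - 1))) +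
      Real.exp (m₁ * ((1 - P.ε₂) * (y - 1)) + m₂ * (P.ε₁ * (y - 1))
        + (n - k) * ((1 - P.δ₁) * (1 / y - 1))) +
      Real.exp (m₂ * (y - 1) + (n - k) * ((1 - P.δ₂) * (1 / y - 1))) := by
  -- Averaging the sum of both errors yields one generator good for both receivers.
  obtain ⟨G, hG⟩ := exists_le_average fun G : Generator n m₁ m₂ =>
    (linearCode k G).error₁ P + (linearCode k G).error₂ P
  refine ⟨linearCode k G, hG.trans ?_⟩
  rw [average_add]
  refine add_le_add ((average_error₁_le P k hδ₁ hε₁ hε₂ hy₁ hy₂).trans ?_)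
    ((average_error₂_le P k hδ₂ hε₁ hε₂ hy₁ hy₂).trans ?_)
  all_goals
    have hz₀ : 0 ≤ 1 / y := by positivity
    have hz₁ : 1 / y ≤ 1 := (div_le_one (by linarith)).2 hy₁
    have hpos {p : ℝ} (hp : 0 ≤ p) : 0 ≤ p * (y - 1) := mul_nonneg hp (by linarith)
    have hz {δ : ℝ} (h : 0 ≤ δ ∧ δ < 1) : -1 ≤ (1 - δ) * (1 / y - 1) := by nlinarith
    rw [card_filter_not_val_lt hk]
    simp only [Real.exp_add, ← Nat.cast_sub hk]
  · rw [card_filter_val_lt hk]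
    have h1 := one_add_pow_le_exp (x := P.ε₂ * (y - 1)) (by linarith [hpos hε₂.1]) m₁
    have h2 := one_add_pow_le_exp (x := P.ε₁ * (y - 1)) (by linarith [hpos hε₁.1]) m₂
    have h3 := one_add_pow_le_exp (x := (1 - P.ε₂) * (y - 1))
      (by linarith [hpos (sub_nonneg.2 hε₂.2)]) m₁
    have h4 := one_add_pow_le_exp (hz hδ₁)
    have h5 (m : ℕ) : 0 ≤ (1 + (1 - P.δ₁) * (1 / y - 1)) ^ m := pow_nonneg (by linarith [hz hδ₁]) m
    have h6 : 0 ≤ (1 + P.ε₁ * (y - 1)) ^ m₂ := pow_nonneg (by linarith [hpos hε₁.1]) _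
    gcongr
    · exact h5 _
    · exact h4 _
    · exact h5 _
    · exact h4 _
  · have h1 := one_add_pow_le_exp (x := y - 1) (by linarith) m₂
    rw [add_sub_cancel] at h1
    have h4 := one_add_pow_le_exp (hz hδ₂)
    have h5 (m : ℕ) : 0 ≤ (1 + (1 - P.δ₂) * (1 / y - 1)) ^ m := pow_nonneg (by linarith [hz hδ₂]) m
    gcongr
    · exact h5 _
    · exact h4 _

theorem Code.error₁_nonneg {n m₁ m₂ : ℕ} (c : Code n m₁ m₂) {P : Params}
    (hδ₁ : 0 ≤ P.δ₁ ∧ P.δ₁ < 1) (hε₁ : 0 ≤ P.ε₁ ∧ P.ε₁ ≤ 1) (hε₂ : 0 ≤ P.ε₂ ∧ P.ε₂ ≤ 1) :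
    0 ≤ c.error₁ P := by
  have h0 {p : ℝ} (h₀ : 0 ≤ p) (h₁ : p ≤ 1) {k : ℕ} {f : Bits k → ℝ} (hf : ∀ s, 0 ≤ f s) :
      0 ≤ bernoulliMean p f :=
    (bernoulliMean_const p 0).symm.le.trans (bernoulliMean_mono h₀ h₁ hf)
  rw [Code.error₁_eq]
  refine h0 (by linarith) (by linarith) fun e₁ => h0 (by linarith) (by linarith) fun e₂ =>
    h0 (by linarith) (by linarith) fun s => ?_
  rw [messageFraction]
  positivity

theorem Code.error₂_nonneg {n m₁ m₂ : ℕ} (c : Code n m₁ m₂) {P : Params}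
    (hδ₂ : 0 ≤ P.δ₂ ∧ P.δ₂ < 1) (hε₁ : 0 ≤ P.ε₁ ∧ P.ε₁ ≤ 1) (hε₂ : 0 ≤ P.ε₂ ∧ P.ε₂ ≤ 1) :
    0 ≤ c.error₂ P := by
  rw [← Code.error₁_swap]
  exact Code.error₁_nonneg c.swap hδ₂ hε₂ hε₁

/-! ### Achievable rates and the capacity region -/

theorem tendsto_exp_zero_of_div {u : ℕ → ℝ} {L : ℝ} (hL : L < 0)
    (h : Tendsto (fun n : ℕ => u n / n) atTop (𝓝 L)) :
    Tendsto (fun n => Real.exp (u n)) atTop (𝓝 0) := by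
  refine Real.tendsto_exp_atBot.comp ?_
  refine (Filter.Tendsto.atTop_mul_neg hL (tendsto_natCast_atTop_atTop (R := ℝ)) h).congr' ?_
  filter_upwards [eventually_gt_atTop 0] with n hn
  have : (n : ℝ) ≠ 0 := by exact_mod_cast hn.ne'
  field_simp

theorem exists_dilation {α₁ β₁ α₂ β₂ α₃ β₃ : ℝ} (h₁ : α₁ < β₁) (h₂ : α₂ < β₂) (h₃ : α₃ < β₃) :
    ∃ y : ℝ, 1 < y ∧ y ≤ 2 ∧ y * α₁ < β₁ ∧ y * α₂ < β₂ ∧ y * α₃ < β₃ := by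
  have h {α β : ℝ} (hαβ : α < β) : ∀ᶠ y in 𝓝[>] (1 : ℝ), y * α < β := by
    have : Tendsto (fun y : ℝ => y * α) (𝓝 1) (𝓝 α) :=
      (continuous_id.mul continuous_const).tendsto' _ _ (by simp)
    exact (this.mono_left nhdsWithin_le_nhds).eventually_lt_const hαβ
  have h0 : ∀ᶠ y in 𝓝[>] (1 : ℝ), y ∈ Set.Ioc (1 : ℝ) 2 := Ioc_mem_nhdsGT (by norm_num)
  obtain ⟨y, hy, hy₁, hy₂, hy₃⟩ := (h0.and ((h h₁).and ((h h₂).and (h h₃)))).exists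
  exact ⟨y, hy.1, hy.2, hy₁, hy₂, hy₃⟩

/-- Each condition says that, per channel use, the unknown bits are fewer than the equations
received: receiver 1 in phase one, receiver 1 in phase two, receiver 2 in phase two. -/
theorem achievable_of_timeSharing {P : Params} {R : ℝ × ℝ} {a : ℝ}
    (hδ₁ : 0 ≤ P.δ₁ ∧ P.δ₁ < 1) (hδ₂ : 0 ≤ P.δ₂ ∧ P.δ₂ < 1)
    (hε₁ : 0 ≤ P.ε₁ ∧ P.ε₁ ≤ 1) (hε₂ : 0 ≤ P.ε₂ ∧ P.ε₂ ≤ 1)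
    (hR₁ : 0 ≤ R.1) (hR₂ : 0 ≤ R.2) (ha₀ : 0 ≤ a) (ha₁ : a ≤ 1)
    (h₁ : P.ε₂ * R.1 < (1 - P.δ₁) * a)
    (h₂ : (1 - P.ε₂) * R.1 + P.ε₁ * R.2 < (1 - P.δ₁) * (1 - a))
    (h₃ : R.2 < (1 - P.δ₂) * (1 - a)) : Achievable P R := by
  obtain ⟨y, hy, hy₂, g₁, g₂, g₃⟩ := exists_dilation h₁ h₂ h₃
  have hk (n : ℕ) : ⌊a * n⌋₊ ≤ n := by
    have : a * n ≤ n := mul_le_of_le_one_left (Nat.cast_nonneg n) ha₁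
    exact_mod_cast (Nat.floor_le (by positivity)).trans this
  choose c hc using fun n : ℕ =>
    exists_code (m₁ := ⌈(n : ℝ) * R.1⌉₊) (m₂ := ⌈(n : ℝ) * R.2⌉₊) (hk n) P hδ₁ hδ₂ hε₁ hε₂ hy.le hy₂
  have hm₁ := tendsto_ceil_mul_div hR₁
  have hm₂ := tendsto_ceil_mul_div hR₂
  have hfl : Tendsto (fun n : ℕ => (⌊a * n⌋₊ : ℝ) / n) atTop (𝓝 a) :=
    (tendsto_nat_floor_mul_div_atTop ha₀).comp (tendsto_natCast_atTop_atTop (R := ℝ))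
  have hn : Tendsto (fun n : ℕ => (n : ℝ) / n) atTop (𝓝 1) := by
    refine tendsto_const_nhds.congr' ?_
    filter_upwards [eventually_gt_atTop 0] with n hn
    rw [div_self (by exact_mod_cast hn.ne')]
  -- The limiting exponent factors as (yα - β)(y - 1)/y, so y must exceed 1 yet preserve the strict
  -- inequality.
  have hneg {α β : ℝ} (h : y * α < β) : α * (y - 1) + β * (1 / y - 1) < 0 := by
    have : α * (y - 1) + β * (1 / y - 1) = (y * α - β) * ((y - 1) / y) := by
      field_simp
      ring
    rw [this]
    exact mul_neg_of_neg_of_pos (by linarith) (div_pos (by linarith) (by linarith))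
  have l₁ := tendsto_exp_zero_of_div (u := fun n : ℕ => ⌈(n : ℝ) * R.1⌉₊ * (P.ε₂ * (y - 1))
      + ⌊a * n⌋₊ * ((1 - P.δ₁) * (1 / y - 1))) (hneg g₁) <| by
    have := (hm₁.mul_const (P.ε₂ * (y - 1))).add (hfl.mul_const ((1 - P.δ₁) * (1 / y - 1)))
    convert this using 2 <;> ring
  have l₂ := tendsto_exp_zero_of_div (u := fun n : ℕ =>
      ⌈(n : ℝ) * R.1⌉₊ * ((1 - P.ε₂) * (y - 1)) + ⌈(n : ℝ) * R.2⌉₊ * (P.ε₁ * (y - 1))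
      + (n - ⌊a * n⌋₊) * ((1 - P.δ₁) * (1 / y - 1))) (hneg g₂) <| by
    have := ((hm₁.mul_const ((1 - P.ε₂) * (y - 1))).add (hm₂.mul_const (P.ε₁ * (y - 1)))).add
      ((hn.sub hfl).mul_const ((1 - P.δ₁) * (1 / y - 1)))
    convert this using 2 <;> ring
  have l₃ := tendsto_exp_zero_of_div (u := fun n : ℕ => ⌈(n : ℝ) * R.2⌉₊ * (y - 1)
      + (n - ⌊a * n⌋₊) * ((1 - P.δ₂) * (1 / y - 1))) (hneg g₃) <| by
    have := (hm₂.mul_const (y - 1)).add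
      ((hn.sub hfl).mul_const ((1 - P.δ₂) * (1 / y - 1)))
    convert this using 2 <;> ring
  have hl := (l₁.add l₂).add l₃
  simp only [add_zero] at hl
  refine ⟨hR₁, hR₂, c, ?_, ?_⟩
  · refine squeeze_zero (fun n => (c n).error₁_nonneg hδ₁ hε₁ hε₂) (fun n => ?_) hl
    linarith [hc n, (c n).error₂_nonneg hδ₂ hε₁ hε₂]
  · refine squeeze_zero (fun n => (c n).error₂_nonneg hδ₂ hε₁ hε₂) (fun n => ?_) hl
    linarith [hc n, (c n).error₁_nonneg hδ₁ hε₁ hε₂]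

theorem achievable_of_lt_of_le {P : Params} {R : ℝ × ℝ}
    (hδ₁ : 0 ≤ P.δ₁ ∧ P.δ₁ < 1) (hδ₂ : 0 ≤ P.δ₂ ∧ P.δ₂ < 1)
    (hε₁ : 0 ≤ P.ε₁ ∧ P.ε₁ ≤ 1) (hε₂ : 0 ≤ P.ε₂ ∧ P.ε₂ ≤ 1) (hδ : P.δ₁ ≤ P.δ₂)
    (hR₁ : 0 ≤ R.1) (hR₂ : 0 ≤ R.2) (h₁ : P.β₁ * R.1 + R.2 < 1 - P.δ₂)
    (h₂ : R.1 + P.β₂ * R.2 < 1 - P.δ₁) : Achievable P R := by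
  have c₁ : 0 < 1 - P.δ₁ := by linarith
  have c₂ : 0 < 1 - P.δ₂ := by linarith
  have hβ₁ : P.β₁ = P.ε₂ * ((1 - P.δ₂) / (1 - P.δ₁)) := by
    rw [Params.β₁, min_eq_left ((div_le_one c₁).2 (by linarith))]
  have hβ₂ : P.β₂ = P.ε₁ := by
    rw [Params.β₂, min_eq_right ((one_le_div c₂).2 (by linarith)), mul_one]
  rw [hβ₁] at h₁
  rw [hβ₂] at h₂
  have hx : 0 ≤ P.ε₂ * R.1 / (1 - P.δ₁) := div_nonneg (mul_nonneg hε₂.1 hR₁) c₁.le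
  have hz : 0 ≤ R.2 / (1 - P.δ₂) := div_nonneg hR₂ c₂.le
  have g₁ : P.ε₂ * R.1 / (1 - P.δ₁) < 1 - R.2 / (1 - P.δ₂) := by
    have : (P.ε₂ * ((1 - P.δ₂) / (1 - P.δ₁)) * R.1 + R.2) / (1 - P.δ₂) < 1 := (div_lt_one c₂).2 h₁
    have e : (P.ε₂ * ((1 - P.δ₂) / (1 - P.δ₁)) * R.1 + R.2) / (1 - P.δ₂)
        = P.ε₂ * R.1 / (1 - P.δ₁) + R.2 / (1 - P.δ₂) := by field_simp
    linarith
  have g₂ : P.ε₂ * R.1 / (1 - P.δ₁)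
      < 1 - ((1 - P.ε₂) * R.1 + P.ε₁ * R.2) / (1 - P.δ₁) := by
    have : (R.1 + P.ε₁ * R.2) / (1 - P.δ₁) < 1 := (div_lt_one c₁).2 h₂
    have e : (R.1 + P.ε₁ * R.2) / (1 - P.δ₁)
        = P.ε₂ * R.1 / (1 - P.δ₁) + ((1 - P.ε₂) * R.1 + P.ε₁ * R.2) / (1 - P.δ₁) := by ring
    linarith
  -- Phase one needs `a` above the left side, phase two needs it below `g₁` for receiver 2 and `g₂`
  -- for receiver 1. That these bounds leave room is exactly the two rate constraints.
  obtain ⟨a, ha, ha'⟩ := exists_between (lt_min g₁ g₂)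
  obtain ⟨ha₁, ha₂⟩ := lt_min_iff.1 ha'
  refine achievable_of_timeSharing (a := a) hδ₁ hδ₂ hε₁ hε₂ hR₁ hR₂ (hx.trans ha.le)
    (by linarith) ?_ ?_ ?_
  · rwa [div_lt_iff₀' c₁] at ha
  · rwa [lt_sub_comm, div_lt_iff₀' c₁] at ha₂
  · rwa [lt_sub_comm, div_lt_iff₀' c₂] at ha₁

theorem achievable_of_lt {P : Params} {R : ℝ × ℝ}
    (hδ₁ : 0 ≤ P.δ₁ ∧ P.δ₁ < 1) (hδ₂ : 0 ≤ P.δ₂ ∧ P.δ₂ < 1)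
    (hε₁ : 0 ≤ P.ε₁ ∧ P.ε₁ ≤ 1) (hε₂ : 0 ≤ P.ε₂ ∧ P.ε₂ ≤ 1)
    (hR₁ : 0 ≤ R.1) (hR₂ : 0 ≤ R.2) (h₁ : P.β₁ * R.1 + R.2 < 1 - P.δ₂)
    (h₂ : R.1 + P.β₂ * R.2 < 1 - P.δ₁) : Achievable P R := by
  rcases le_total P.δ₁ P.δ₂ with hδ | hδ
  · exact achievable_of_lt_of_le hδ₁ hδ₂ hε₁ hε₂ hδ hR₁ hR₂ h₁ h₂
  · have h₁' : P.swap.β₁ * R.swap.1 + R.swap.2 < 1 - P.swap.δ₂ := (add_comm _ _).trans_lt h₂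
    have h₂' : R.swap.1 + P.swap.β₂ * R.swap.2 < 1 - P.swap.δ₁ := (add_comm _ _).trans_lt h₁
    exact (achievable_of_lt_of_le hδ₂ hδ₁ hε₂ hε₁ hδ hR₂ hR₁ h₁' h₂').swap

theorem Achievable.bound₁ {P : Params} {R : ℝ × ℝ} (h : Achievable P R)
    (hδ₁ : 0 ≤ P.δ₁ ∧ P.δ₁ < 1) (hδ₂ : 0 ≤ P.δ₂ ∧ P.δ₂ < 1)
    (hε₁ : 0 ≤ P.ε₁ ∧ P.ε₁ ≤ 1) (hε₂ : 0 ≤ P.ε₂ ∧ P.ε₂ ≤ 1) :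
    R.1 + P.β₂ * R.2 ≤ 1 - P.δ₁ :=
  (add_comm _ _).trans_le (h.swap.bound₂ hδ₂ hδ₁ hε₂ hε₁)

end CachedBEC

theorem theorem1 (P : CachedBEC.Params)
    (hδ₁ : 0 ≤ P.δ₁ ∧ P.δ₁ < 1) (hδ₂ : 0 ≤ P.δ₂ ∧ P.δ₂ < 1)
    (hε₁ : 0 ≤ P.ε₁ ∧ P.ε₁ ≤ 1) (hε₂ : 0 ≤ P.ε₂ ∧ P.ε₂ ≤ 1) :
    CachedBEC.capacityRegion P =
      {R : ℝ × ℝ | 0 ≤ R.1 ∧ 0 ≤ R.2 ∧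
        P.β₁ * R.1 + R.2 ≤ 1 - P.δ₂ ∧
        R.1 + P.β₂ * R.2 ≤ 1 - P.δ₁} := by
  apply subset_antisymm
  · refine closure_minimal (fun R hR => ⟨hR.1, hR.2.1, hR.bound₂ hδ₁ hδ₂ hε₁ hε₂,
      hR.bound₁ hδ₁ hδ₂ hε₁ hε₂⟩) ?_
    simp only [Set.ofPred_and]
    refine IsClosed.inter ?_ (IsClosed.inter ?_ (IsClosed.inter ?_ ?_)) <;>
      exact isClosed_le (by fun_prop) (by fun_prop)
  · rintro R ⟨hR₁, hR₂, h₁, h₂⟩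
    -- Shrinking `R` towards the origin makes both constraints strict, since 1 - δᵢ > 0, and keeps
    -- the rates nonnegative.
    have ht : Tendsto (fun x : ℝ => x • R) (𝓝[<] 1) (𝓝 R) := by
      have : Tendsto (fun x : ℝ => x • R) (𝓝 1) (𝓝 R) :=
        (continuous_id.smul continuous_const).tendsto' _ _ (by simp)
      exact this.mono_left nhdsWithin_le_nhds
    refine mem_closure_of_tendsto ht ?_
    filter_upwards [Ioo_mem_nhdsLT (zero_lt_one' ℝ)] with x hx
    have hlt {u v : ℝ} (h : u ≤ 1 - v) (hv : v < 1) : x * u < 1 - v :=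
      (mul_le_mul_of_nonneg_left h hx.1.le).trans_lt (mul_lt_of_lt_one_left (by linarith) hx.2)
    refine CachedBEC.achievable_of_lt hδ₁ hδ₂ hε₁ hε₂ (mul_nonneg hx.1.le hR₁)
      (mul_nonneg hx.1.le hR₂) (lt_of_eq_of_lt ?_ (hlt h₁ hδ₂.2)) (lt_of_eq_of_lt ?_ (hlt h₂ hδ₁.2))
    · simp only [Prod.smul_fst, Prod.smul_snd, smul_eq_mul]
      ring
    · simp only [Prod.smul_fst, Prod.smul_snd, smul_eq_mul]
      ring
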